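/- Let $n\ge 0$. Let $\mathcal T(n,n)$ be the set of standard Young tableaux of shape $(n,n)$ (entries $1,\dots,2n$), let $S_{2n}$ act on tableaux by permuting entries, and let $s_i=(i\ \,i+1)$. Let $T\le S$ in $\mathcal T(n,n)$ if and only if there is a (possibly empty) directed path from $T$ to $S$ in the tableau graph, whose directed edges are $T\to R$ with $R=s_i.T$ for some $i$ such that $i$ lies in $T$ in a row underneath $i+1$; this is a partial order. Let $S^{(n,n)}$ be the complex Specht module, the span of all polytabloids $v_T=\sum_{g}\operatorname{sgn}(g)\{gT\}$ ($g$ in the column group of $T$, $\{\cdot\}$ denoting tabloids), where $T$ is a tableau of shape $(n,n)$. Let $W^{(n,n)}$ be the complex vector space with basis the cup diagrams (noncrossing perfect matchings) on $2n$ dots, on which $s_i$ acts by $s_i.w=-w$ if $i$ and $i+1$ are joined in $w$, and otherwise by $s_i.w=w+w'$, where $w'$ arises from $w$ by joining $i$ to $i+1$, joining their former partners to each other, and keeping all other arcs. This defines a unique representation of $S_{2n}$ on $W^{(n,n)}$. For $T\in\mathcal T(n,n)$ let $w_T=\phi(T)$ be the unique cup diagram whose left endpoints are the entries of the first row of $T$.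 Let $T_0$ be the tableau with $1,2,\dots,2n$ down successive columns. There is a unique isomorphism of $S_{2n}$-modules $\rho\colon S^{(n,n)}\to W^{(n,n)}$ with $\rho(v_{T_0})=w_{T_0}$. Write $\rho(v_T)=\sum_{S\in\mathcal T(n,n)}a_{ST}\,w_S$ for $T\in\mathcal T(n,n)$. Then for all $S,T\in\mathcal T(n,n)$, $a_{ST}>0$ (that is, $a_{ST}$ is a positive real number) if and only if $S\le T$. -/

import Mathlib

open Equiv
open scoped ComplexOrder

/-! ### Tableaux of shape `(n, n)` and the tableau graph

The letters `1, …, 2n` are represented by `Fin (2 * n)`, i.e. they are shifted to `0, …, 2n - 1`;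
row `0` is the upper row and row `1` is the lower row. -/

/-- A Young tableau of shape `(n, n)`: every letter is written in exactly one box. -/
abbrev Tableau (n : ℕ) : Type := (Fin 2 × Fin n) ≃ Fin (2 * n)

namespace Tableau

variable {n : ℕ}

/-- The symmetric group acts on tableaux by acting on the entries. -/
def act (g : Perm (Fin (2 * n))) (T : Tableau n) : Tableau n := T.trans g

/-- The row containing the letter `x`. -/
def row (T : Tableau n) (x : Fin (2 * n)) : Fin 2 := (T.symm x).1

/-- The column containing the letter `x`. -/
def col (T : Tableau n) (x : Fin (2 * n)) : Fin n := (T.symm x).2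

/-- Entries increase along each row and each column. -/
def IsStandard (T : Tableau n) : Prop :=
  (∀ r : Fin 2, StrictMono fun c : Fin n => T (r, c)) ∧ ∀ c : Fin n, T (0, c) < T (1, c)

/-- The tableau whose entries `1, 2, …, 2n` run down successive columns. -/
def columnReading (n : ℕ) : Tableau n :=
  (Equiv.prodComm (Fin 2) (Fin n)).trans (finProdFinEquiv.trans (finCongr (Nat.mul_comm n 2)))

theorem columnReading_val (r : Fin 2) (c : Fin n) :
    (columnReading n (r, c)).val = r.val + 2 * c.val := by
  simp [columnReading]

theorem columnReading_isStandard (n : ℕ) : (columnReading n).IsStandard := by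
  refine ⟨fun r c d h => ?_, fun c => ?_⟩
  · rw [Fin.lt_def, columnReading_val, columnReading_val]
    have : c.val < d.val := h
    omega
  · rw [Fin.lt_def, columnReading_val, columnReading_val]
    simp

end Tableau

/-- The simple transposition exchanging the neighbouring letters `i` and `i + 1`. -/
def simpleSwap {n : ℕ} (i : ℕ) (hi : i + 1 < 2 * n) : Perm (Fin (2 * n)) :=
  swap ⟨i, Nat.lt_of_succ_lt hi⟩ ⟨i + 1, hi⟩

/-- Standard Young tableaux of shape `(n, n)`. -/
def StdTableau (n : ℕ) : Type := {T : Tableau n // T.IsStandard}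

namespace StdTableau

variable {n : ℕ}

/-- The standard tableau with `1, 2, …, 2n` down successive columns. -/
def initial (n : ℕ) : StdTableau n :=
  ⟨Tableau.columnReading n, Tableau.columnReading_isStandard n⟩

/-- Directed edges `T → R` of the tableau graph: `R = s_i . T` for some `i` that lies in `T` in a
row underneath the row of `i + 1`. -/
def Edge (T R : StdTableau n) : Prop :=
  ∃ (i : ℕ) (hi : i + 1 < 2 * n),
    T.1.row ⟨i + 1, hi⟩ < T.1.row ⟨i, Nat.lt_of_succ_lt hi⟩ ∧
      R.1 = T.1.act (simpleSwap i hi)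

/-- The sum of the entries of the upper row; it drops along every edge of the tableau graph. -/
def topSum (T : StdTableau n) : ℕ := ∑ c : Fin n, (T.1 (0, c)).val

theorem Edge.topSum_lt {T R : StdTableau n} (h : Edge T R) : R.topSum < T.topSum := by
  obtain ⟨i, hi, hrow, hR⟩ := h
  have key : ∀ c : Fin n, R.1 (0, c) = simpleSwap i hi (T.1 (0, c)) := fun c => by
    rw [hR]; rfl
  have hrow1 : (T.1.symm ⟨i + 1, hi⟩).1 = 0 := by
    simp only [Tableau.row] at hrow; omega
  have hrow2 : (T.1.symm ⟨i, Nat.lt_of_succ_lt hi⟩).1 ≠ 0 := by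
    simp only [Tableau.row] at hrow; omega
  have hne : ∀ c : Fin n, T.1 (0, c) ≠ ⟨i, Nat.lt_of_succ_lt hi⟩ := fun c hc =>
    hrow2 (by rw [← hc]; simp)
  have hval : ∀ c : Fin n, T.1 (0, c) ≠ ⟨i + 1, hi⟩ → R.1 (0, c) = T.1 (0, c) := fun c hc => by
    rw [key, simpleSwap, swap_apply_of_ne_of_ne (hne c) hc]
  have hval' : ∀ c : Fin n, T.1 (0, c) = ⟨i + 1, hi⟩ → (R.1 (0, c)).val < (T.1 (0, c)).val :=
    fun c hc => by rw [key, simpleSwap, hc, swap_apply_right]; simp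
  refine Finset.sum_lt_sum (fun c _ => ?_)
    ⟨(T.1.symm ⟨i + 1, hi⟩).2, Finset.mem_univ _, hval' _ ?_⟩
  · by_cases hc : T.1 (0, c) = ⟨i + 1, hi⟩
    · exact (hval' c hc).le
    · rw [hval c hc]
  · rw [← hrow1]; simp

/-- `T ≤ S` if and only if there is a directed path from `T` to `S` in the tableau graph. -/
instance : PartialOrder (StdTableau n) where
  le T S := Relation.ReflTransGen Edge T S
  le_refl _ := Relation.ReflTransGen.refl
  le_trans _ _ _ h h' := Relation.ReflTransGen.trans h h'
  le_antisymm T S h h' := by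
    have mono : ∀ {A B : StdTableau n}, Relation.ReflTransGen Edge A B → B.topSum ≤ A.topSum := by
      intro A B hAB
      induction hAB with
      | refl => exact le_rfl
      | tail _ e ih => exact e.topSum_lt.le.trans ih
    rcases Relation.ReflTransGen.cases_head h with h | ⟨A, e, hA⟩
    · exact h
    · exact absurd (e.topSum_lt.trans_le (mono h')) (mono hA).not_gt

end StdTableau

/-! ### The Specht module -/

/-- Two tableaux are row equivalent if every letter lies in the same row of both. -/
def rowSetoid (n : ℕ) : Setoid (Tableau n) where
  r T T' := ∀ x, T.row x = T'.row x
  iseqv := ⟨fun _ _ => rfl, fun h x => (h x).symm, fun h h' x => (h x).trans (h' x)⟩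

/-- Tabloids of shape `(n, n)`: row equivalence classes of tableaux. -/
def Tabloid (n : ℕ) : Type := Quotient (rowSetoid n)

namespace Tabloid

variable {n : ℕ}

/-- The tabloid of a tableau. -/
def mk (T : Tableau n) : Tabloid n := Quotient.mk (rowSetoid n) T

instance : MulAction (Perm (Fin (2 * n))) (Tabloid n) where
  smul g := Quotient.map (Tableau.act g) fun _ _ h x => h (g.symm x)
  one_smul t := Quotient.inductionOn t fun _ => rfl
  mul_smul _ _ t := Quotient.inductionOn t fun _ => rfl

theorem smul_mk (g : Perm (Fin (2 * n))) (T : Tableau n) : g • mk T = mk (T.act g) := rfl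

end Tabloid

/-- The permutation module on tabloids. -/
noncomputable abbrev tabloidRep (n : ℕ) :
    Representation ℂ (Perm (Fin (2 * n))) (MonoidAlgebra ℂ (Tabloid n)) :=
  Representation.ofMulAction ℂ (Perm (Fin (2 * n))) (Tabloid n)

open Classical in
/-- The column group of a tableau: the permutations preserving every column. -/
noncomputable def columnGroup {n : ℕ} (T : Tableau n) : Finset (Perm (Fin (2 * n))) :=
  {g | ∀ x, T.col (g x) = T.col x}

theorem mem_columnGroup {n : ℕ} (T : Tableau n) (g : Perm (Fin (2 * n))) :
    g ∈ columnGroup T ↔ ∀ x, T.col (g x) = T.col x := by simp [columnGroup]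

/-- The polytabloid `∑ g, sgn(g) {g T}`, with `g` running over the column group of `T`. -/
noncomputable def polytabloid {n : ℕ} (T : Tableau n) : MonoidAlgebra ℂ (Tabloid n) :=
  ∑ g ∈ columnGroup T, MonoidAlgebra.single (g • Tabloid.mk T) ((Perm.sign g : ℤ) : ℂ)

theorem tabloidRep_polytabloid {n : ℕ} (g : Perm (Fin (2 * n))) (T : Tableau n) :
    tabloidRep n g (polytabloid T) = polytabloid (T.act g) := by
  simp only [polytabloid, map_sum, Representation.ofMulAction_single]
  refine Finset.sum_bij' (fun h _ => g * h * g⁻¹) (fun h _ => g⁻¹ * h * g) ?_ ?_ ?_ ?_ ?_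
  · intro h hh
    simp only [mem_columnGroup, Tableau.col, Tableau.act] at hh ⊢
    intro x
    have := hh (g.symm x)
    simpa [Equiv.symm_trans_apply, Perm.mul_apply] using this
  · intro h hh
    simp only [mem_columnGroup, Tableau.col, Tableau.act] at hh ⊢
    intro x
    have := hh (g x)
    simpa [Equiv.symm_trans_apply, Perm.mul_apply] using this
  · intro h _; group
  · intro h _; group
  · intro h _
    have h1 : Perm.sign (g * h * g⁻¹) = Perm.sign h := by
      rw [map_mul, map_mul, map_inv, mul_comm, inv_mul_cancel_left]
    rw [h1, ← Tabloid.smul_mk, smul_smul, smul_smul, inv_mul_cancel_right]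

/-- The Specht module `S^{(n,n)}`: the span of all polytabloids inside the permutation module. -/
noncomputable def specht (n : ℕ) : Subrepresentation (tabloidRep n) where
  toSubmodule := Submodule.span ℂ (Set.range polytabloid)
  apply_mem_toSubmodule g v hv := by
    induction hv using Submodule.span_induction with
    | mem x hx =>
      obtain ⟨T, rfl⟩ := hx
      rw [tabloidRep_polytabloid]
      exact Submodule.subset_span ⟨_, rfl⟩
    | zero => rw [map_zero]; exact Submodule.zero_mem _
    | add x y _ _ hx hy => rw [map_add]; exact Submodule.add_mem _ hx hy
    | smul a x _ hx => rw [map_smul]; exact Submodule.smul_mem _ a hx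

/-- The action of the symmetric group on the Specht module. -/
noncomputable abbrev spechtRep (n : ℕ) :
    Representation ℂ (Perm (Fin (2 * n))) (specht n).toSubmodule :=
  (specht n).toRepresentation

/-- The standard polytabloid `v_T`, as an element of the Specht module. -/
noncomputable def stdPolytabloid {n : ℕ} (T : StdTableau n) : (specht n).toSubmodule :=
  ⟨polytabloid T.1, Submodule.subset_span ⟨T.1, rfl⟩⟩

/-! ### Cup diagrams -/

/-- A cup diagram on `2n` dots: a noncrossing perfect matching, given by the map sending each dot
to the other endpoint of its arc. -/
@[ext]
structure CupDiagram (n : ℕ) where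
  /-- the other endpoint of the arc at a dot -/
  partner : Fin (2 * n) → Fin (2 * n)
  partner_partner : ∀ x, partner (partner x) = x
  partner_ne : ∀ x, partner x ≠ x
  noncrossing : ∀ a b, a < b → b < partner a → partner a < partner b → False

namespace CupDiagram

variable {n : ℕ}

/-- The cup diagram in which `i` and `i + 1` are joined, the former partners of `i` and `i + 1`
are joined to each other, and all other arcs are kept. (If `i` and `i + 1` are already joined,
nothing changes.) -/
def reconnect (w : CupDiagram n) (i : ℕ) (hi : i + 1 < 2 * n) : CupDiagram n where
  partner x :=
    if x = ⟨i, Nat.lt_of_succ_lt hi⟩ then ⟨i + 1, hi⟩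
    else if x = ⟨i + 1, hi⟩ then ⟨i, Nat.lt_of_succ_lt hi⟩
    else if x = w.partner ⟨i, Nat.lt_of_succ_lt hi⟩ then w.partner ⟨i + 1, hi⟩
    else if x = w.partner ⟨i + 1, hi⟩ then w.partner ⟨i, Nat.lt_of_succ_lt hi⟩
    else w.partner x
  partner_partner x := by
    have := w.partner_partner
    have := w.partner_ne
    grind
  partner_ne x := by
    have := w.partner_partner
    have := w.partner_ne
    grind
  noncrossing a b := by
    have h1 := w.partner_partner
    have h2 := w.partner_ne
    have h3 := w.noncrossing
    have hij : ∀ x : Fin (2 * n), x < ⟨i, Nat.lt_of_succ_lt hi⟩ ∨ x = ⟨i, Nat.lt_of_succ_lt hi⟩ ∨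
        x = ⟨i + 1, hi⟩ ∨ ⟨i + 1, hi⟩ < x := fun x => by
      simp only [Fin.lt_def, Fin.ext_iff]; omega
    have hlt : (⟨i, Nat.lt_of_succ_lt hi⟩ : Fin (2 * n)) < ⟨i + 1, hi⟩ := by simp [Fin.lt_def]
    generalize (⟨i, Nat.lt_of_succ_lt hi⟩ : Fin (2 * n)) = u at *
    generalize (⟨i + 1, hi⟩ : Fin (2 * n)) = v at *
    intro hab hb hc
    have ha := hij a
    have hb' := hij b
    have hpu := hij (w.partner u)
    have hpv := hij (w.partner v)
    have hpa := hij (w.partner a)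
    have hpb := hij (w.partner b)
    grind (splits := 40)

/-- A cup diagram is determined by its left endpoints. -/
theorem ext_of_left (w w' : CupDiagram n) (h : ∀ x, x < w.partner x ↔ x < w'.partner x) :
    w = w' := by
  have key : ∀ y, w.partner y < y → w'.partner y = w.partner y := by
    intro y
    induction y using WellFoundedLT.induction with
    | ind y ih =>
      intro hy
      have a1 := w.partner_partner
      have a2 := w'.partner_partner
      have b1 := w.partner_ne
      have b2 := w'.partner_ne
      have hy' : w'.partner y < y := by
        have := h y
        grind
      have hl := h (w.partner y)
      have hl' := h (w'.partner y)
      rcases lt_trichotomy (w.partner y) (w'.partner y) with hlt | heq | hlt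
      · have := w.noncrossing (w.partner y) (w'.partner y) hlt
        have := ih (w.partner (w'.partner y))
        grind
      · exact heq.symm
      · have := w'.noncrossing (w'.partner y) (w.partner y) hlt
        have := ih (w'.partner (w.partner y))
        have := h (w'.partner (w.partner y))
        grind
  ext1
  funext x
  have a1 := w.partner_partner
  have a2 := w'.partner_partner
  have b1 := w.partner_ne
  have k1 := key x
  have k2 := key (w.partner x)
  grind

end CupDiagram

/-- The web module `W^{(n,n)}` as a vector space: its basis is indexed by the cup diagrams. -/
abbrev WebSpace (n : ℕ) : Type := CupDiagram n →₀ ℂ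

/-- The web basis vector of a cup diagram. -/
noncomputable abbrev web {n : ℕ} (w : CupDiagram n) : WebSpace n := Finsupp.single w 1

open Classical in
/-- The operator by which `s_i` acts on webs: `s_i . w = -w` if `i` and `i + 1` are joined in `w`,
and otherwise `s_i . w = w + w'`, where `w'` is obtained from `w` by joining `i` with `i + 1` and
the former partners of `i` and `i + 1` with each other. -/
noncomputable def webSwap {n : ℕ} (i : ℕ) (hi : i + 1 < 2 * n) : WebSpace n →ₗ[ℂ] WebSpace n :=
  Finsupp.linearCombination ℂ fun w : CupDiagram n =>
    if w.partner ⟨i, Nat.lt_of_succ_lt hi⟩ = ⟨i + 1, hi⟩ then -web w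
    else web w + web (w.reconnect i hi)

/-- `σ` is the action of the symmetric group on the web module: simple transpositions act by the
web rule. -/
def IsWebAction {n : ℕ} (σ : Representation ℂ (Perm (Fin (2 * n))) (WebSpace n)) : Prop :=
  ∀ (i : ℕ) (hi : i + 1 < 2 * n), σ (simpleSwap i hi) = webSwap i hi

/-! ### The bijection from standard tableaux to cup diagrams -/

namespace StdTableau

variable {n : ℕ}

/-- The number of upper entries minus the number of lower entries among the first `k` letters. -/
def height (T : StdTableau n) (k : ℕ) : ℤ :=
  ∑ c : Fin n, ((if (T.1 (0, c)).val < k then 1 else 0) - (if (T.1 (1, c)).val < k then 1 else 0))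

theorem height_nonneg (T : StdTableau n) (k : ℕ) : 0 ≤ T.height k := by
  refine Finset.sum_nonneg fun c _ => ?_
  have : (T.1 (0, c)).val < (T.1 (1, c)).val := T.2.2 c
  split_ifs <;> omega

theorem height_zero (T : StdTableau n) : T.height 0 = 0 := by simp [height]

theorem height_end (T : StdTableau n) : T.height (2 * n) = 0 := by simp [height]

theorem height_succ (T : StdTableau n) (x : Fin (2 * n)) :
    T.height (x.val + 1) = T.height x.val + if T.1.row x = 0 then 1 else -1 := by
  obtain ⟨⟨r, c⟩, rfl⟩ := T.1.surjective x
  have e : ∀ (r' : Fin 2) (c' : Fin n),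
      (if (T.1 (r', c')).val < (T.1 (r, c)).val + 1 then (1 : ℤ) else 0)
        = (if (T.1 (r', c')).val < (T.1 (r, c)).val then 1 else 0)
          + if r' = r ∧ c' = c then 1 else 0 := by
    intro r' c'
    have h : (T.1 (r', c')).val = (T.1 (r, c)).val ↔ r' = r ∧ c' = c := by
      rw [← Fin.ext_iff, T.1.injective.eq_iff, Prod.mk.injEq]
    by_cases hh : r' = r ∧ c' = c
    · have := h.2 hh
      simp [hh]
    · have := mt h.1 hh
      simp only [hh, if_false]
      split_ifs <;> omega
  have hr : T.1.row (T.1 (r, c)) = r := by simp [Tableau.row]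
  simp only [height, e, hr]
  rw [← sub_eq_iff_eq_add', ← Finset.sum_sub_distrib]
  have : ∀ c' : Fin n, (((if (T.1 (0, c')).val < (T.1 (r, c)).val then (1 : ℤ) else 0)
      + if (0 : Fin 2) = r ∧ c' = c then 1 else 0)
      - ((if (T.1 (1, c')).val < (T.1 (r, c)).val then (1 : ℤ) else 0)
      + if (1 : Fin 2) = r ∧ c' = c then 1 else 0))
      - ((if (T.1 (0, c')).val < (T.1 (r, c)).val then (1 : ℤ) else 0)
        - if (T.1 (1, c')).val < (T.1 (r, c)).val then (1 : ℤ) else 0)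
      = if c' = c then (if r = 0 then 1 else -1) else 0 := by
    intro c'
    by_cases h : c' = c
    · fin_cases r <;> simp [h]
    · simp [h]
  simp only [this, Finset.sum_ite_eq', Finset.mem_univ, if_true]

/-- `x` and `y` are the endpoints of an arc: the height first returns after the letter `y` to its
value before the letter `x`. -/
def Pair (T : StdTableau n) (x y : Fin (2 * n)) : Prop :=
  x < y ∧ T.height (y.val + 1) = T.height x.val ∧
    ∀ z : ℕ, x.val < z → z ≤ y.val → T.height x.val < T.height z

theorem exists_pair_right (T : StdTableau n) (x : Fin (2 * n)) (hx : T.1.row x = 0) :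
    ∃ y, T.Pair x y := by
  classical
  have hs := T.height_succ x
  rw [if_pos hx] at hs
  have hex : ∃ k, x.val < k ∧ T.height k ≤ T.height x.val :=
    ⟨2 * n, x.2, by rw [height_end]; exact T.height_nonneg _⟩
  obtain ⟨h1, h2⟩ := Nat.find_spec hex
  have hmin : ∀ m, m < Nat.find hex → ¬ (x.val < m ∧ T.height m ≤ T.height x.val) :=
    fun m hm => Nat.find_min hex hm
  have hle : Nat.find hex ≤ 2 * n :=
    Nat.find_min' hex ⟨x.2, by rw [height_end]; exact T.height_nonneg _⟩
  obtain ⟨y, hy⟩ : ∃ y, Nat.find hex = y + 1 := ⟨Nat.find hex - 1, by omega⟩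
  rw [hy] at h1 h2 hmin hle
  have hxy : x.val ≠ y := by rintro rfl; omega
  have hy2 := hmin y (by omega)
  have hs' := T.height_succ ⟨y, by omega⟩
  simp only at hs'
  refine ⟨⟨y, by omega⟩, Fin.lt_def.2 (by simp only; omega), ?_, fun z hz hz' => ?_⟩
  · simp only
    split_ifs at hs' <;> omega
  · have := hmin z (by simp only at hz'; omega)
    omega

theorem exists_pair_left (T : StdTableau n) (y : Fin (2 * n)) (hy : T.1.row y ≠ 0) :
    ∃ x, T.Pair x y := by
  classical
  have hs := T.height_succ y
  rw [if_neg hy] at hs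
  let P : ℕ → Prop := fun k => T.height k ≤ T.height (y.val + 1)
  have hP0 : P 0 := by simp only [P, height_zero]; exact T.height_nonneg _
  have h2 : P (Nat.findGreatest P y.val) := Nat.findGreatest_spec (Nat.zero_le _) hP0
  have h1 : Nat.findGreatest P y.val ≤ y.val := Nat.findGreatest_le _
  have hmax : ∀ m, Nat.findGreatest P y.val < m → m ≤ y.val → ¬ P m :=
    fun m hm hm' => Nat.findGreatest_is_greatest hm hm'
  generalize Nat.findGreatest P y.val = x at h1 h2 hmax
  have hxy : x ≠ y.val := by rintro rfl; simp only [P] at h2; omega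
  have hx1 := hmax (x + 1) (by omega) (by omega)
  have hs' := T.height_succ ⟨x, by omega⟩
  simp only [P] at hs' hx1 h2 hmax
  have heq : T.height (y.val + 1) = T.height x := by
    split_ifs at hs' <;> omega
  refine ⟨⟨x, by omega⟩, Fin.lt_def.2 (by simp only; omega), heq, fun z hz hz' => ?_⟩
  have := hmax z hz hz'
  simp only
  omega

theorem Pair.row_left {T : StdTableau n} {x y : Fin (2 * n)} (h : T.Pair x y) :
    T.1.row x = 0 := by
  have h1 := h.2.2 (x.val + 1) (by omega) h.1
  have := T.height_succ x
  by_contra hx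
  rw [if_neg hx] at this
  omega

theorem Pair.row_right {T : StdTableau n} {x y : Fin (2 * n)} (h : T.Pair x y) :
    T.1.row y ≠ 0 := by
  have h1 := h.2.2 y.val h.1 le_rfl
  have h2 := h.2.1
  have := T.height_succ y
  intro hy
  rw [if_pos hy] at this
  omega

theorem Pair.right_unique {T : StdTableau n} {x y y' : Fin (2 * n)} (h : T.Pair x y)
    (h' : T.Pair x y') : y = y' := by
  rcases lt_trichotomy y y' with hlt | rfl | hlt
  · have := h'.2.2 (y.val + 1) (by have : x.val < y.val := h.1; omega) hlt
    have := h.2.1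
    omega
  · rfl
  · have := h.2.2 (y'.val + 1) (by have : x.val < y'.val := h'.1; omega) hlt
    have := h'.2.1
    omega

theorem Pair.left_unique {T : StdTableau n} {x x' y : Fin (2 * n)} (h : T.Pair x y)
    (h' : T.Pair x' y) : x = x' := by
  have h1 := h.2.1
  have h2 := h'.2.1
  rcases lt_trichotomy x x' with hlt | rfl | hlt
  · have := h.2.2 x'.val hlt (by have : x'.val < y.val := h'.1; omega)
    omega
  · rfl
  · have := h'.2.2 x.val hlt (by have : x.val < y.val := h.1; omega)
    omega

theorem Pair.noncrossing {T : StdTableau n} {a b c d : Fin (2 * n)} (h : T.Pair a c)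
    (h' : T.Pair b d) (hab : a < b) (hbc : b < c) (hcd : c < d) : False := by
  have h1 := h.2.2 b.val hab (by have : b.val < c.val := hbc; omega)
  have h2 := h'.2.2 (c.val + 1) (by have : b.val < c.val := hbc; omega) hcd
  have h3 := h.2.1
  omega

/-- There is exactly one cup diagram whose left endpoints are the entries of the upper row. -/
theorem existsUnique_cupDiagram (T : StdTableau n) :
    ∃! w : CupDiagram n, ∀ x, x < w.partner x ↔ T.1.row x = 0 := by
  have hex : ∀ x, ∃ y, T.Pair x y ∨ T.Pair y x := fun x => by
    by_cases hx : T.1.row x = 0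
    · exact (T.exists_pair_right x hx).imp fun _ => Or.inl
    · exact (T.exists_pair_left x hx).imp fun _ => Or.inr
  choose p hp using hex
  have hlt : ∀ x, x < p x → T.Pair x (p x) := fun x hx =>
    (hp x).resolve_right fun h => absurd h.1 hx.not_gt
  refine ⟨⟨p, fun x => ?_, fun x => ?_, fun a b hab hb hc => ?_⟩, fun x => ⟨?_, ?_⟩, ?_⟩
  · rcases hp x with h | h <;> rcases hp (p x) with h' | h'
    · exact absurd h'.row_left h.row_right
    · exact h'.left_unique h
    · exact h'.right_unique h
    · exact absurd h.row_left h'.row_right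
  · rcases hp x with h | h
    · exact h.1.ne'
    · exact h.1.ne
  · exact (hlt a (hab.trans hb)).noncrossing (hlt b (hb.trans hc)) hab hb hc
  · exact fun h => (hlt x h).row_left
  · intro hx
    rcases hp x with h | h
    · exact h.1
    · exact absurd hx h.row_right
  · intro w' hw'
    refine CupDiagram.ext_of_left w' _ fun x => (hw' x).trans ⟨fun hx => ?_, fun hx => ?_⟩
    · rcases hp x with h | h
      · exact h.1
      · exact absurd hx h.row_right
    · exact (hlt x hx).row_left

/-- The bijection `φ`: the cup diagram whose left endpoints are the entries of the upper row. -/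
noncomputable def phi (T : StdTableau n) : CupDiagram n := T.existsUnique_cupDiagram.choose

theorem phi_spec (T : StdTableau n) (x : Fin (2 * n)) :
    x < T.phi.partner x ↔ T.1.row x = 0 := T.existsUnique_cupDiagram.choose_spec.1 x

theorem eq_phi (T : StdTableau n) (w : CupDiagram n)
    (h : ∀ x, x < w.partner x ↔ T.1.row x = 0) : w = T.phi :=
  T.existsUnique_cupDiagram.choose_spec.2 w h

end StdTableau

/-- The entry `a_{ST}` of the transition matrix: the coefficient of `w_S = φ(S)` in the expansion
of `ρ(v_T)` in the web basis. -/
noncomputable def transitionEntry {n : ℕ}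
    {σ : Representation ℂ (Perm (Fin (2 * n))) (WebSpace n)} (ρ : (spechtRep n).Equiv σ)
    (S T : StdTableau n) : ℂ :=
  (ρ (stdPolytabloid T) : WebSpace n) S.phi

/-! A perfect matching `p` of the dots defines the function `r ↦ ∏ (r (p x) - r x)`, the product
running over its arcs `x < p x`. If the columns of a tableau increase, the coefficient of its
polytabloid at a tabloid is this function for the matching by columns, evaluated at the 0/1 vector
of rows (`polytabloid_coeff_eq_matchEval`). The identity (C - A)(D - B) = (B - A)(D - C) + (D - A)(C
- B) resolves a crossing into two other matchings (`matchEval_plucker`), and it gives the web rule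
for `s_i` when `i` and `i + 1` are not joined. Hence turning the arcs of a cup diagram into columns
embeds the web module equivariantly into the permutation module (`webToTabloid_injective`), with
image the Specht module (`range_webToTabloid`). The map ρ is the inverse, and the numbers a_{ST}
arise by uncrossing the column matching of T.

Uncrossing involves only plus signs, so all a_{ST} are nonnegative. It never raises the height
function, and nested resolutions keep the left endpoints; so w_T occurs in ρ(v_T), and w_S occurs
only if the heights of S are at most those of T. In that case S ≤ T, because peaks of T can be
lowered one at a time until S is reached (`le_of_height_le`).

Conversely, along an edge T → R the matching of T is one of the two resolutions of a crossing in the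
matching of R, so no coefficient decreases (`Edge.webCoord_le`). Starting from a_{SS} > 0 this
yields a_{ST} > 0 whenever S ≤ T. -/

/-! ### Perfect matchings and products of differences -/

/-- The product of the differences `r (p x) - r x` over the arcs `x < p x` of a matching `p`. -/
noncomputable def matchEval {m : ℕ} (p : Fin m → Fin m) (r : Fin m → ℂ) : ℂ :=
  ∏ x, if x < p x then r (p x) - r x else 1

/-- The number of left endpoints minus the number of right endpoints among the first `k` dots. -/
def matchHeight {m : ℕ} (p : Fin m → Fin m) (k : ℕ) : ℤ :=
  ∑ x, if x.val < k then (if x < p x then 1 else -1) else 0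

/-- A measure of the spread of a matching that drops whenever a crossing is resolved. -/
def matchSpread {m : ℕ} (p : Fin m → Fin m) : ℤ :=
  ∑ x, (2 * m * |((p x).val : ℤ) - x.val| - (((p x).val : ℤ) - x.val) ^ 2)

/-- An endpoint of an arc of length t contributes t(2m - t), and t ≤ m. On this range t(2m - t) is
increasing and strictly concave, which is what makes the spread drop under both resolutions of a
crossing. -/
theorem matchSpread_nonneg {m : ℕ} (p : Fin m → Fin m) : 0 ≤ matchSpread p := by
  refine Finset.sum_nonneg fun x _ => ?_
  rw [← sq_abs]
  have h1 := abs_nonneg (((p x).val : ℤ) - x.val)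
  have h2 : |((p x).val : ℤ) - x.val| ≤ m := by
    rw [abs_le]; omega
  nlinarith

/-! ### Resolving a crossing on four dots -/

section FourDots

variable {m : ℕ} {p q : Fin m → Fin m} {a b c d : Fin m}

theorem prod_fourDots {R : Type*} [CommMonoid R] (f : Fin m → R) (hab : a < b) (hbc : b < c)
    (hcd : c < d) :
    ∏ x, f x = f a * f b * f c * f d * ∏ x ∈ ({a, b, c, d} : Finset (Fin m))ᶜ, f x := by
  rw [← Finset.prod_mul_prod_compl ({a, b, c, d} : Finset (Fin m))]
  congr 1
  have := hab.trans hbc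
  have := hbc.trans hcd
  have := hab.trans (hbc.trans hcd)
  rw [Finset.prod_insert, Finset.prod_insert, Finset.prod_pair hcd.ne]
  · simp only [mul_assoc]
  · simp only [Finset.mem_insert, Finset.mem_singleton]; grind
  · simp only [Finset.mem_insert, Finset.mem_singleton]; grind

theorem sum_fourDots {R : Type*} [AddCommMonoid R] (f : Fin m → R) (hab : a < b) (hbc : b < c)
    (hcd : c < d) :
    ∑ x, f x = f a + f b + f c + f d + ∑ x ∈ ({a, b, c, d} : Finset (Fin m))ᶜ, f x :=
  prod_fourDots (R := Multiplicative R) f hab hbc hcd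

theorem mem_compl_fourDots {x : Fin m} (hx : x ∈ ({a, b, c, d} : Finset (Fin m))ᶜ) :
    x ≠ a ∧ x ≠ b ∧ x ≠ c ∧ x ≠ d := by
  simpa using hx

/-- The dots `a < b < c < d` carry the arcs `ac` and `bd`, which cross. -/
structure Crossing (p : Fin m → Fin m) (a b c d : Fin m) : Prop where
  ab : a < b
  bc : b < c
  cd : c < d
  pa : p a = c
  pb : p b = d
  pc : p c = a
  pd : p d = b

/-- `q` is obtained from `p` by replacing arcs among `a, b, c, d` by the arcs `ab` and `cd`. -/
structure JoinedSplit (p q : Fin m → Fin m) (a b c d : Fin m) : Prop where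
  qa : q a = b
  qb : q b = a
  qc : q c = d
  qd : q d = c
  other : ∀ x, x ≠ a → x ≠ b → x ≠ c → x ≠ d → q x = p x

/-- `q` is obtained from `p` by replacing arcs among `a, b, c, d` by the arcs `ad` and `bc`. -/
structure JoinedNested (p q : Fin m → Fin m) (a b c d : Fin m) : Prop where
  qa : q a = d
  qb : q b = c
  qc : q c = b
  qd : q d = a
  other : ∀ x, x ≠ a → x ≠ b → x ≠ c → x ≠ d → q x = p x

/-- The three-term Plücker relation; the factors away from the four dots are common to all three
products. -/
theorem matchEval_plucker {q' : Fin m → Fin m} (h : Crossing p a b c d)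
    (hq : JoinedSplit p q a b c d) (hq' : JoinedNested p q' a b c d) (r : Fin m → ℂ) :
    matchEval p r = matchEval q r + matchEval q' r := by
  obtain ⟨hab, hbc, hcd, h1, h2, h3, h4⟩ := h
  simp only [matchEval, prod_fourDots _ hab hbc hcd]
  have e1 : ∏ x ∈ ({a, b, c, d} : Finset (Fin m))ᶜ, (if x < q x then r (q x) - r x else 1)
      = ∏ x ∈ ({a, b, c, d} : Finset (Fin m))ᶜ, (if x < p x then r (p x) - r x else 1) := by
    refine Finset.prod_congr rfl fun x hx => ?_
    obtain ⟨k1, k2, k3, k4⟩ := mem_compl_fourDots hx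
    rw [hq.other x k1 k2 k3 k4]
  have e2 : ∏ x ∈ ({a, b, c, d} : Finset (Fin m))ᶜ, (if x < q' x then r (q' x) - r x else 1)
      = ∏ x ∈ ({a, b, c, d} : Finset (Fin m))ᶜ, (if x < p x then r (p x) - r x else 1) := by
    refine Finset.prod_congr rfl fun x hx => ?_
    obtain ⟨k1, k2, k3, k4⟩ := mem_compl_fourDots hx
    rw [hq'.other x k1 k2 k3 k4]
  rw [e1, e2, h1, h2, h3, h4, hq.qa, hq.qb, hq.qc, hq.qd, hq'.qa, hq'.qb, hq'.qc, hq'.qd]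
  have hac := hab.trans hbc
  have hbd := hbc.trans hcd
  have had := hac.trans hcd
  simp only [hab, hbc, hcd, hac, hbd, had, hab.not_gt, hbc.not_gt, hcd.not_gt, hac.not_gt,
    hbd.not_gt, had.not_gt, if_true, if_false]
  ring

/-- The left endpoints `a, b` are replaced by `a, c`; moving a left endpoint to the right can only
lower the prefix counts. -/
theorem JoinedSplit.matchHeight_le (h : Crossing p a b c d) (hq : JoinedSplit p q a b c d)
    (k : ℕ) : matchHeight q k ≤ matchHeight p k := by
  obtain ⟨hab, hbc, hcd, h1, h2, h3, h4⟩ := h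
  simp only [matchHeight, sum_fourDots _ hab hbc hcd]
  refine add_le_add ?_ (Finset.sum_le_sum fun x hx => ?_)
  · rw [h1, h2, h3, h4, hq.qa, hq.qb, hq.qc, hq.qd]
    have hac := hab.trans hbc
    have hbd := hbc.trans hcd
    have had := hac.trans hcd
    simp only [hab, hcd, hac, hbd, hab.not_gt, hcd.not_gt, hac.not_gt,
      hbd.not_gt, if_true, if_false]
    rw [Fin.lt_def] at *
    split_ifs <;> omega
  · obtain ⟨k1, k2, k3, k4⟩ := mem_compl_fourDots hx
    rw [hq.other x k1 k2 k3 k4]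

/-- Among the four dots, `a` and `b` are the left endpoints before and after. -/
theorem JoinedNested.lt_iff (h : Crossing p a b c d) (hq : JoinedNested p q a b c d) (x : Fin m) :
    x < q x ↔ x < p x := by
  obtain ⟨hab, hbc, hcd, h1, h2, h3, h4⟩ := h
  obtain ⟨k1, k2, k3, k4, k5⟩ := hq
  have := k5 x
  grind

/-- Both arcs get shorter, from `c - a` to `b - a` and from `d - b` to `d - c`, and t(2m - t)
increases up to t = m. -/
theorem JoinedSplit.matchSpread_lt (h : Crossing p a b c d) (hq : JoinedSplit p q a b c d) :
    matchSpread q < matchSpread p := by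
  obtain ⟨hab, hbc, hcd, h1, h2, h3, h4⟩ := h
  simp only [matchSpread, sum_fourDots _ hab hbc hcd]
  refine add_lt_add_of_lt_of_le ?_ (Finset.sum_le_sum fun x hx => ?_)
  · rw [h1, h2, h3, h4, hq.qa, hq.qb, hq.qc, hq.qd]
    rw [Fin.lt_def] at *
    have hd := d.2
    generalize a.val = a at *
    generalize b.val = b at *
    generalize c.val = c at *
    generalize d.val = d at *
    rw [abs_sub_comm (a : ℤ) b, abs_sub_comm (c : ℤ) d, abs_sub_comm (a : ℤ) c,
      abs_sub_comm (b : ℤ) d, abs_of_pos (by omega : (b : ℤ) - a > 0),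
      abs_of_pos (by omega : (d : ℤ) - c > 0), abs_of_pos (by omega : (c : ℤ) - a > 0),
      abs_of_pos (by omega : (d : ℤ) - b > 0)]
    obtain ⟨u, rfl⟩ := Nat.exists_eq_add_of_lt hab
    obtain ⟨v, rfl⟩ := Nat.exists_eq_add_of_lt hbc
    obtain ⟨w, rfl⟩ := Nat.exists_eq_add_of_lt hcd
    obtain ⟨z, rfl⟩ := Nat.exists_eq_add_of_lt hd
    push_cast
    nlinarith [mul_nonneg (Int.natCast_nonneg u) (Int.natCast_nonneg v),
      mul_nonneg (Int.natCast_nonneg w) (Int.natCast_nonneg v),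
      mul_nonneg (Int.natCast_nonneg v) (Int.natCast_nonneg v),
      mul_nonneg (Int.natCast_nonneg v) (Int.natCast_nonneg z),
      mul_nonneg (Int.natCast_nonneg v) (Int.natCast_nonneg a)]
  · obtain ⟨k1, k2, k3, k4⟩ := mem_compl_fourDots hx
    rw [hq.other x k1 k2 k3 k4]

/-- The total length of the two arcs is unchanged but the lengths move apart, so strict concavity of
t(2m - t) applies. -/
theorem JoinedNested.matchSpread_lt (h : Crossing p a b c d) (hq : JoinedNested p q a b c d) :
    matchSpread q < matchSpread p := by
  obtain ⟨hab, hbc, hcd, h1, h2, h3, h4⟩ := h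
  simp only [matchSpread, sum_fourDots _ hab hbc hcd]
  refine add_lt_add_of_lt_of_le ?_ (Finset.sum_le_sum fun x hx => ?_)
  · rw [h1, h2, h3, h4, hq.qa, hq.qb, hq.qc, hq.qd]
    rw [Fin.lt_def] at *
    generalize a.val = a at *
    generalize b.val = b at *
    generalize c.val = c at *
    generalize d.val = d at *
    rw [abs_sub_comm (a : ℤ) d, abs_sub_comm (b : ℤ) c, abs_sub_comm (a : ℤ) c,
      abs_sub_comm (b : ℤ) d, abs_of_pos (by omega : (d : ℤ) - a > 0),
      abs_of_pos (by omega : (c : ℤ) - b > 0), abs_of_pos (by omega : (c : ℤ) - a > 0),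
      abs_of_pos (by omega : (d : ℤ) - b > 0)]
    -- The linear terms cancel, and the sum of the squared lengths of the two arcs grows by 2(b -
    -- a)(d - c).
    have : 0 < ((b : ℤ) - a) * (d - c) := mul_pos (by omega) (by omega)
    nlinarith
  · obtain ⟨k1, k2, k3, k4⟩ := mem_compl_fourDots hx
    rw [hq.other x k1 k2 k3 k4]

/-- Perfect matchings: fixed point free involutions. -/
structure IsPerfectMatching (p : Fin m → Fin m) : Prop where
  invol : ∀ x, p (p x) = x
  ne : ∀ x, p x ≠ x

theorem exists_joinedSplit (hp : IsPerfectMatching p) (h : Crossing p a b c d) :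
    ∃ q, IsPerfectMatching q ∧ JoinedSplit p q a b c d := by
  obtain ⟨hab, hbc, hcd, h1, h2, h3, h4⟩ := h
  obtain ⟨i1, i2⟩ := hp
  refine ⟨fun x => if x = a then b else if x = b then a else if x = c then d else
    if x = d then c else p x, ⟨?_, ?_⟩, ⟨?_, ?_, ?_, ?_, ?_⟩⟩ <;> grind

theorem exists_joinedNested (hp : IsPerfectMatching p) (h : Crossing p a b c d) :
    ∃ q, IsPerfectMatching q ∧ JoinedNested p q a b c d := by
  obtain ⟨hab, hbc, hcd, h1, h2, h3, h4⟩ := h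
  obtain ⟨i1, i2⟩ := hp
  refine ⟨fun x => if x = a then d else if x = b then c else if x = c then b else
    if x = d then a else p x, ⟨?_, ?_⟩, ⟨?_, ?_, ?_, ?_, ?_⟩⟩ <;> grind

end FourDots

/-- Conjugating a matching by an order preserving permutation of its arcs. -/
theorem matchEval_conj {m : ℕ} {p q : Fin m → Fin m} (s : Perm (Fin m))
    (hq : ∀ x, q (s x) = s (p x)) (hs : ∀ x, s x < s (p x) ↔ x < p x) (r : Fin m → ℂ) :
    matchEval q r = matchEval p (r ∘ s) := by
  unfold matchEval
  rw [← Equiv.prod_comp s]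
  simp only [hq, hs, Function.comp_apply]

/-- Only the factor of the arc `uv` sees the swap, and it changes sign. -/
theorem matchEval_comp_eq_neg {m : ℕ} {p : Fin m → Fin m} {u v : Fin m} (huv : u < v)
    (hp : IsPerfectMatching p) (hu : p u = v) (r : Fin m → ℂ) :
    matchEval p (r ∘ swap u v) = -matchEval p r := by
  have hv : p v = u := by rw [← hu, hp.invol]
  unfold matchEval
  rw [← Finset.mul_prod_erase _ _ (Finset.mem_univ u), ← Finset.mul_prod_erase Finset.univ
    (fun x => if x < p x then r (p x) - r x else 1) (Finset.mem_univ u)]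
  have : ∏ x ∈ Finset.univ.erase u,
        (if x < p x then (r ∘ swap u v) (p x) - (r ∘ swap u v) x else 1)
      = ∏ x ∈ Finset.univ.erase u, (if x < p x then r (p x) - r x else 1) := by
    refine Finset.prod_congr rfl fun x hx => ?_
    have hxu := Finset.ne_of_mem_erase hx
    by_cases hxv : x = v
    · rw [hxv, hv, if_neg huv.not_gt, if_neg huv.not_gt]
    · have h1 : p x ≠ u := fun h => hxv (by rw [← hp.invol x, h, hu])
      have h2 : p x ≠ v := fun h => hxu (by rw [← hp.invol x, h, hv])
      simp only [Function.comp_apply, swap_apply_of_ne_of_ne hxu hxv, swap_apply_of_ne_of_ne h1 h2]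
  rw [this, hu, if_pos huv, if_pos huv]
  simp only [Function.comp_apply, swap_apply_left, swap_apply_right]
  ring

/-! ### The web rule as an identity of products -/

namespace CupDiagram

variable {n : ℕ}

theorem isPerfectMatching (w : CupDiagram n) : IsPerfectMatching w.partner :=
  ⟨w.partner_partner, w.partner_ne⟩

instance : Finite (CupDiagram n) :=
  Finite.of_injective partner fun _ _ h => CupDiagram.ext h

/-- Precomposing with `s_i` conjugates the matching. As `i` and `i + 1` are neighbours and not
joined, no arc changes orientation, and their two arcs, which did not cross, now cross. The two
resolutions of this crossing are `w` and its reconnection. -/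
theorem matchEval_comp_simpleSwap (w : CupDiagram n) (i : ℕ) (hi : i + 1 < 2 * n)
    (h : w.partner ⟨i, Nat.lt_of_succ_lt hi⟩ ≠ ⟨i + 1, hi⟩) (r : Fin (2 * n) → ℂ) :
    matchEval w.partner (r ∘ simpleSwap i hi)
      = matchEval w.partner r + matchEval (w.reconnect i hi).partner r := by
  have hij : ∀ x : Fin (2 * n), x < ⟨i, Nat.lt_of_succ_lt hi⟩ ∨ x = ⟨i, Nat.lt_of_succ_lt hi⟩ ∨
      x = ⟨i + 1, hi⟩ ∨ ⟨i + 1, hi⟩ < x := fun x => by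
    simp only [Fin.lt_def, Fin.ext_iff]; omega
  have hrec : ∀ x, (w.reconnect i hi).partner x =
    if x = ⟨i, Nat.lt_of_succ_lt hi⟩ then ⟨i + 1, hi⟩
    else if x = ⟨i + 1, hi⟩ then ⟨i, Nat.lt_of_succ_lt hi⟩
    else if x = w.partner ⟨i, Nat.lt_of_succ_lt hi⟩ then w.partner ⟨i + 1, hi⟩
    else if x = w.partner ⟨i + 1, hi⟩ then w.partner ⟨i, Nat.lt_of_succ_lt hi⟩
    else w.partner x := fun x => rfl
  have huv : (⟨i, Nat.lt_of_succ_lt hi⟩ : Fin (2 * n)) < ⟨i + 1, hi⟩ := by simp [Fin.lt_def]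
  unfold simpleSwap
  generalize (w.reconnect i hi).partner = q at *
  generalize (⟨i, Nat.lt_of_succ_lt hi⟩ : Fin (2 * n)) = u at *
  generalize (⟨i + 1, hi⟩ : Fin (2 * n)) = v at *
  have h1 := w.partner_partner
  have h2 := w.partner_ne
  have h3 := w.noncrossing
  generalize w.partner = p at *
  set s : Perm (Fin (2 * n)) := swap u v with hs
  have su : s u = v := swap_apply_left _ _
  have sv : s v = u := swap_apply_right _ _
  have sx : ∀ x, x ≠ u → x ≠ v → s x = x := fun x => swap_apply_of_ne_of_ne
  have hpv : p v ≠ u := fun e => h (by rw [← e, h1])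
  have hlt : ∀ x, s x < s (p x) ↔ x < p x := by
    intro x
    have e1 := hij x
    have e2 := hij (p x)
    have e3 := sx x
    have e4 := sx (p x)
    grind
  rw [← matchEval_conj (q := fun x => s (p (s x))) s (fun x => by simp [hs]) hlt]
  -- Noncrossing leaves three positions for the partners: on either side of `u, v`, both to the
  -- right, or both to the left.
  have hnc : Crossing (fun x => s (p (s x))) (p u) u v (p v) ∨
      Crossing (fun x => s (p (s x))) u v (p v) (p u) ∨
      Crossing (fun x => s (p (s x))) (p v) (p u) u v := by
    have a1 := hij (p u)
    have a2 := hij (p v)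
    have b1 := h3 u v huv
    have b2 := h3 (p u) (p v)
    have b3 := h3 (p v) (p u)
    have b4 := h3 (p v) u
    have b5 := h3 (p u) v
    have e1 := sx (p u)
    have e2 := sx (p v)
    have c1 := h1 u
    have c2 := h1 v
    have d1 := h2 u
    have d2 := h2 v
    have f1 : p u ≠ v := h
    have g1 : s (p (s u)) = p v := by grind
    have g2 : s (p (s v)) = p u := by grind
    have g3 : s (p (s (p u))) = v := by grind
    have g4 : s (p (s (p v))) = u := by grind
    rcases lt_trichotomy (p u) u with k1 | k1 | k1
    · rcases lt_trichotomy v (p v) with k2 | k2 | k2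
      · exact Or.inl ⟨k1, huv, k2, g3, g1, g2, g4⟩
      · exact absurd k2.symm d2
      · have : p v < p u := by grind
        exact Or.inr (Or.inr ⟨this, k1, huv, g4, g3, g1, g2⟩)
    · exact absurd k1 d1
    · have k2 : v < p v := by grind
      have : p v < p u := by grind
      exact Or.inr (Or.inl ⟨huv, k2, this, g1, g2, g4, g3⟩)
  have oth : ∀ x, x ≠ u → x ≠ v → x ≠ p u → x ≠ p v → s (p (s x)) = p x ∧ q x = p x := by
    intro x x1 x2 x3 x4
    have e3 := sx x
    have e4 := sx (p x)
    grind
  have q1 : q u = v := by simp [hrec]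
  have q2 : q v = u := by simp [hrec, huv.ne']
  have q3 : q (p u) = p v := by have := h2 u; grind
  have q4 : q (p v) = p u := by have := h2 v; have := h2 u; grind
  rcases hnc with hc | hc | hc
  · refine matchEval_plucker hc ⟨h1 u, rfl, rfl, h1 v, fun x x1 x2 x3 x4 => ?_⟩
      ⟨q3, q1, q2, q4, fun x x1 x2 x3 x4 => ?_⟩ r
    · exact (oth x x2 x3 x1 x4).1.symm
    · exact (oth x x2 x3 x1 x4).2.trans (oth x x2 x3 x1 x4).1.symm
  -- When both partners lie on the same side, `w` is the nested resolution and the reconnection is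
  -- the split one; in the preceding case it is the other way round.
  · rw [add_comm]
    refine matchEval_plucker hc ⟨q1, q2, q4, q3, fun x x1 x2 x3 x4 => ?_⟩
      ⟨rfl, rfl, h1 v, h1 u, fun x x1 x2 x3 x4 => ?_⟩ r
    · exact (oth x x1 x2 x4 x3).2.trans (oth x x1 x2 x4 x3).1.symm
    · exact (oth x x1 x2 x4 x3).1.symm
  · rw [add_comm]
    refine matchEval_plucker hc ⟨q4, q3, q1, q2, fun x x1 x2 x3 x4 => ?_⟩
      ⟨h1 v, h1 u, rfl, rfl, fun x x1 x2 x3 x4 => ?_⟩ r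
    · exact (oth x x3 x4 x2 x1).2.trans (oth x x3 x4 x2 x1).1.symm
    · exact (oth x x3 x4 x2 x1).1.symm

end CupDiagram

/-! ### Coefficients of polytabloids -/

namespace Tabloid

variable {n : ℕ}

/-- The row of a letter in a tabloid. -/
def row (t : Tabloid n) : Fin (2 * n) → Fin 2 := Quotient.lift Tableau.row (fun _ _ h => funext h) t

@[simp]
theorem row_mk (T : Tableau n) : row (mk T) = T.row := rfl

theorem row_injective : Function.Injective (row (n := n)) := by
  intro t t'
  induction t using Quotient.inductionOn
  induction t' using Quotient.inductionOn
  exact fun h => Quotient.sound fun x => congrFun h x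

theorem row_smul (g : Perm (Fin (2 * n))) (t : Tabloid n) (x : Fin (2 * n)) :
    row (g • t) x = row t (g⁻¹ x) := by
  induction t using Quotient.inductionOn
  rfl

instance : Finite (Tabloid n) := Finite.of_injective row row_injective

/-- The row of a letter in a tabloid as a complex number, `0` or `1`. -/
noncomputable def rowVec (t : Tabloid n) (x : Fin (2 * n)) : ℂ := ((row t x).val : ℂ)

theorem rowVec_smul (g : Perm (Fin (2 * n))) (t : Tabloid n) :
    rowVec (g • t) = rowVec t ∘ ⇑g⁻¹ := by
  funext x
  simp only [rowVec, row_smul, Function.comp_apply]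

end Tabloid

/-- The contribution of one column to a polytabloid coefficient: at most one arrangement of its two
letters has the prescribed rows, and none has if both letters are prescribed the same row. -/
theorem sum_sign_rowPattern (f : Fin 2 → Fin 2) :
    ∑ π : Perm (Fin 2), (if ∀ r, f (π r) = r then ((Perm.sign π : ℤ) : ℂ) else 0)
      = ((f 1).val : ℂ) - ((f 0).val : ℂ) := by
  have hu : (Finset.univ : Finset (Perm (Fin 2))) = {1, swap 0 1} := by decide
  rw [hu, Finset.sum_pair (by decide)]
  simp only [Fin.forall_fin_two, Perm.one_apply, swap_apply_left, swap_apply_right, Perm.sign_one,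
    Perm.sign_swap (show (0 : Fin 2) ≠ 1 by decide)]
  generalize f 0 = a
  generalize f 1 = b
  fin_cases a <;> fin_cases b <;> simp

open Tabloid in
-- The column group is a product of `n` copies of the symmetric group on two boxes, and the sign is
-- multiplicative, so the signed sum factors over the columns.
theorem polytabloid_coeff {n : ℕ} (T : Tableau n) (t : Tabloid n) :
    (polytabloid T).coeff t = ∏ c : Fin n, (rowVec t (T (1, c)) - rowVec t (T (0, c))) := by
  classical
  have key : ∀ g : Perm (Fin (2 * n)), g • mk T = t ↔ ∀ c r, row t (g (T (r, c))) = r := by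
    intro g
    rw [← (row_injective (n := n)).eq_iff]
    constructor
    · intro h c r
      rw [← h, row_smul]
      simp [Tableau.row]
    · intro h
      funext x
      rw [row_smul, row_mk]
      obtain ⟨⟨r, c⟩, hrc⟩ := T.surjective (g⁻¹ x)
      have : x = g (T (r, c)) := by rw [hrc]; simp
      rw [this, h]
      simp [Tableau.row]
  simp only [rowVec]
  have hprod : ∀ c : Fin n, ((row t (T (1, c))).val : ℂ) - ((row t (T (0, c))).val : ℂ) =
      ∑ π : Perm (Fin 2), (if ∀ r, row t (T (π r, c)) = r then ((Perm.sign π : ℤ) : ℂ) else 0) :=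
    fun c => (sum_sign_rowPattern fun r => row t (T (r, c))).symm
  simp only [hprod, Finset.prod_univ_sum, Fintype.piFinset_univ]
  rw [polytabloid, MonoidAlgebra.coeff_sum, Finsupp.finsetSum_apply]
  symm
  -- A family `σ` of row permutations, one for each column, is read as a permutation of the letters
  -- through `T`.
  refine Finset.sum_bij (fun σ _ => T.permCongr (prodCongrLeft σ)) ?_ ?_ ?_ ?_
  · intro σ _
    rw [mem_columnGroup]
    intro x
    simp [Tableau.col, permCongr_apply]
  · intro σ _ τ _ h
    have h' := T.permCongr.injective h
    funext c
    ext r : 1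
    have := congrArg (fun e : Perm (Fin 2 × Fin n) => (e (r, c)).1) h'
    simpa using this
  · intro g hg
    rw [mem_columnGroup] at hg
    have hcol : ∀ c r, (T.symm (g (T (r, c)))).2 = c := fun c r => by
      simpa [Tableau.col] using hg (T (r, c))
    have hinj : ∀ c, Function.Injective fun r => (T.symm (g (T (r, c)))).1 := by
      intro c r r' h
      have : T.symm (g (T (r, c))) = T.symm (g (T (r', c))) :=
        Prod.ext h ((hcol c r).trans (hcol c r').symm)
      simpa using this
    refine ⟨fun c => Equiv.ofBijective _ (Finite.injective_iff_bijective.1 (hinj c)),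
      Finset.mem_univ _, ?_⟩
    ext x : 1
    obtain ⟨⟨r, c⟩, rfl⟩ := T.surjective x
    rw [permCongr_apply, symm_apply_apply, prodCongrLeft_apply, ofBijective_apply,
      ← T.apply_symm_apply (g (T (r, c)))]
    congr 1
    exact Prod.ext (by simp) (by simp [hcol])
  · intro σ _
    rw [MonoidAlgebra.coeff_single, Finsupp.single_apply, Perm.sign_permCongr, Perm.sign_prodCongrLeft]
    have hcond : (T.permCongr (prodCongrLeft σ) • mk T = t) ↔
        ∀ c ∈ (Finset.univ : Finset (Fin n)), ∀ r, row t (T (σ c r, c)) = r := by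
      rw [key]
      simp [permCongr_apply]
    simp only [hcond]
    rw [Finset.prod_ite_zero]
    push_cast
    congr

/-! ### Tableaux and matchings -/

namespace Tableau

variable {n : ℕ}

/-- The entry in the same column as a letter. -/
def partner (T : Tableau n) (x : Fin (2 * n)) : Fin (2 * n) := T (1 - T.row x, T.col x)

theorem partner_zero (T : Tableau n) (c : Fin n) : T.partner (T (0, c)) = T (1, c) := by
  simp [partner, row, col]

theorem partner_one (T : Tableau n) (c : Fin n) : T.partner (T (1, c)) = T (0, c) := by
  simp [partner, row, col]

theorem isPerfectMatching_partner (T : Tableau n) : IsPerfectMatching T.partner := by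
  constructor
  · intro x
    obtain ⟨⟨r, c⟩, rfl⟩ := T.surjective x
    fin_cases r <;> simp [partner_zero, partner_one]
  · intro x
    obtain ⟨⟨r, c⟩, rfl⟩ := T.surjective x
    fin_cases r <;> simp [partner_zero, partner_one]

theorem polytabloid_coeff_eq_matchEval (T : Tableau n) (p : Fin (2 * n) → Fin (2 * n))
    (hT : ∀ c, T (0, c) < T (1, c)) (h0 : ∀ c, p (T (0, c)) = T (1, c))
    (h1 : ∀ c, p (T (1, c)) = T (0, c)) (t : Tabloid n) :
    (polytabloid T).coeff t = matchEval p t.rowVec := by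
  rw [polytabloid_coeff, matchEval, ← Equiv.prod_comp T, Fintype.prod_prod_type,
    Fin.prod_univ_two, ← Finset.prod_mul_distrib]
  refine Finset.prod_congr rfl fun c _ => ?_
  rw [h0, h1, if_pos (hT c), if_neg (hT c).not_gt, mul_one]

end Tableau

/-! ### Triangularity of cup diagrams against tabloids -/

namespace CupDiagram

variable {n : ℕ}

theorem card_left (w : CupDiagram n) : Fintype.card {x // x < w.partner x} = n := by
  have e : {x // x < w.partner x} ≃ {x // ¬ x < w.partner x} :=
    { toFun := fun x => ⟨w.partner x.1, by rw [w.partner_partner]; exact x.2.not_gt⟩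
      invFun := fun x => ⟨w.partner x.1, by
        rw [w.partner_partner]
        exact lt_of_le_of_ne (not_lt.1 x.2) (w.partner_ne _)⟩
      left_inv := fun x => Subtype.ext (w.partner_partner _)
      right_inv := fun x => Subtype.ext (w.partner_partner _) }
  have h1 := Fintype.card_congr e
  have h2 := Fintype.card_subtype_compl fun x => x < w.partner x
  have h3 := Fintype.card_subtype_le fun x => x < w.partner x
  rw [Fintype.card_fin] at h2 h3
  omega

/-- There is a tableau whose columns are the arcs of a given cup diagram. -/
theorem exists_tableau (w : CupDiagram n) :
    ∃ T : Tableau n, (∀ c, T (0, c) < T (1, c)) ∧ ∀ c, w.partner (T (0, c)) = T (1, c) := by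
  have e : Fin n ≃ {x // x < w.partner x} := (Fintype.equivFinOfCardEq w.card_left).symm
  let f : Fin 2 × Fin n → Fin (2 * n) := fun rc =>
    if rc.1 = 0 then (e rc.2).1 else w.partner (e rc.2).1
  have hf : Function.Injective f := by
    rintro ⟨r, c⟩ ⟨r', c'⟩ h
    have a1 := (e c).2
    have a2 := (e c').2
    have a3 := w.partner_partner
    have a4 : (e c).1 = (e c').1 → c = c' := fun h => e.injective (Subtype.ext h)
    have a5 := a3 (e c)
    have a6 := a3 (e c')
    simp only [f] at h
    have : r = 0 ∨ r = 1 := by omega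
    have : r' = 0 ∨ r' = 1 := by omega
    grind
  refine ⟨Equiv.ofBijective f ((Fintype.bijective_iff_injective_and_card f).2 ⟨hf, by simp⟩),
    fun c => ?_, fun c => ?_⟩
  · simpa [f] using (e c).2
  · simp [f]

/-- A tableau whose columns are the arcs of a cup diagram. -/
noncomputable def tableau (w : CupDiagram n) : Tableau n := w.exists_tableau.choose

theorem tableau_lt (w : CupDiagram n) (c : Fin n) : w.tableau (0, c) < w.tableau (1, c) :=
  w.exists_tableau.choose_spec.1 c

theorem partner_tableau_zero (w : CupDiagram n) (c : Fin n) :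
    w.partner (w.tableau (0, c)) = w.tableau (1, c) :=
  w.exists_tableau.choose_spec.2 c

theorem partner_tableau_one (w : CupDiagram n) (c : Fin n) :
    w.partner (w.tableau (1, c)) = w.tableau (0, c) := by
  rw [← partner_tableau_zero, partner_partner]

theorem row_tableau (w : CupDiagram n) (x : Fin (2 * n)) :
    w.tableau.row x = if x < w.partner x then 0 else 1 := by
  obtain ⟨⟨r, c⟩, rfl⟩ := w.tableau.surjective x
  have := w.tableau_lt c
  fin_cases r
  · simp [Tableau.row, partner_tableau_zero, this]
  · simp [Tableau.row, partner_tableau_one, this.not_gt]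

theorem polytabloid_tableau_coeff (w : CupDiagram n) (t : Tabloid n) :
    (polytabloid w.tableau).coeff t = matchEval w.partner t.rowVec :=
  w.tableau.polytabloid_coeff_eq_matchEval _ w.tableau_lt w.partner_tableau_zero
    w.partner_tableau_one t

/-- The sum of the left endpoints. -/
def leftSum (w : CupDiagram n) : ℕ := ∑ x, if x < w.partner x then x.val else 0

theorem matchEval_self (w : CupDiagram n) :
    matchEval w.partner (Tabloid.mk w.tableau).rowVec = 1 := by
  refine Finset.prod_eq_one fun x _ => ?_
  split_ifs with h
  · simp [Tabloid.rowVec, row_tableau, h, w.partner_partner, h.not_gt]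
  · rfl

/-- A nonzero product means that each arc of `w'` contains exactly one left endpoint of `w`.
Choosing the smaller end of every arc, as `w'` does, minimizes the sum, and equality forces the same
choice on every arc. -/
theorem leftSum_le_of_matchEval_ne_zero {w w' : CupDiagram n}
    (h : matchEval w'.partner (Tabloid.mk w.tableau).rowVec ≠ 0) :
    w'.leftSum ≤ w.leftSum ∧ (w'.leftSum = w.leftSum → w' = w) := by
  have hfac : ∀ x, x < w'.partner x →
      ¬ (x < w.partner x ↔ w'.partner x < w.partner (w'.partner x)) := by
    intro x hx hiff
    refine h (Finset.prod_eq_zero (Finset.mem_univ x) ?_)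
    rw [if_pos hx]
    simp only [Tabloid.rowVec, Tabloid.row_mk, row_tableau, hiff, sub_self]
  have hpair : ∀ u : CupDiagram n, u.leftSum = ∑ c, ((if w'.tableau (0, c) <
      u.partner (w'.tableau (0, c)) then (w'.tableau (0, c)).val else 0) +
      if w'.tableau (1, c) < u.partner (w'.tableau (1, c)) then (w'.tableau (1, c)).val else 0) := by
    intro u
    rw [leftSum, ← Equiv.sum_comp w'.tableau, Fintype.sum_prod_type, Fin.sum_univ_two,
      ← Finset.sum_add_distrib]
  have hle : ∀ c ∈ (Finset.univ : Finset (Fin n)),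
      ((if w'.tableau (0, c) < w'.partner (w'.tableau (0, c)) then (w'.tableau (0, c)).val else 0) +
      if w'.tableau (1, c) < w'.partner (w'.tableau (1, c)) then (w'.tableau (1, c)).val else 0) ≤
      ((if w'.tableau (0, c) < w.partner (w'.tableau (0, c)) then (w'.tableau (0, c)).val else 0) +
      if w'.tableau (1, c) < w.partner (w'.tableau (1, c)) then (w'.tableau (1, c)).val else 0) := by
    intro c _
    have h1 := w'.tableau_lt c
    have h2 := hfac (w'.tableau (0, c))
    rw [partner_tableau_zero] at h2
    have h2 := h2 h1
    rw [partner_tableau_zero, partner_tableau_one, if_pos h1, if_neg h1.not_gt]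
    rw [Fin.lt_def] at h1
    split_ifs <;> omega
  refine ⟨?_, fun heq => ?_⟩
  · rw [hpair w', hpair w]
    exact Finset.sum_le_sum hle
  · rw [hpair w', hpair w, Finset.sum_eq_sum_iff_of_le hle] at heq
    refine ext_of_left _ _ fun x => ?_
    obtain ⟨⟨r, c⟩, rfl⟩ := w'.tableau.surjective x
    have h1 := w'.tableau_lt c
    have h2 := hfac (w'.tableau (0, c))
    rw [partner_tableau_zero] at h2
    have h2 := h2 h1
    have h3 := heq c (Finset.mem_univ c)
    rw [partner_tableau_zero, partner_tableau_one, if_pos h1, if_neg h1.not_gt] at h3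
    have h4 : w'.tableau (0, c) < w.partner (w'.tableau (0, c)) := by
      by_contra h4
      have h5 : w'.tableau (1, c) < w.partner (w'.tableau (1, c)) := by tauto
      rw [if_neg h4, if_pos h5] at h3
      rw [Fin.lt_def] at h1
      omega
    have hr : r = 0 ∨ r = 1 := by omega
    rcases hr with rfl | rfl
    · simp only [partner_tableau_zero, h1, h4]
    · simp only [partner_tableau_one, h1.not_gt, false_iff]
      tauto

end CupDiagram

/-! ### The web module inside the permutation module -/

/-- The linear map sending a web to the polytabloid whose columns are its arcs. -/
noncomputable def webToTabloid (n : ℕ) : WebSpace n →ₗ[ℂ] MonoidAlgebra ℂ (Tabloid n) :=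
  Finsupp.linearCombination ℂ fun w : CupDiagram n => polytabloid w.tableau

section WebModule

variable {n : ℕ}

theorem webToTabloid_web (w : CupDiagram n) : webToTabloid n (web w) = polytabloid w.tableau := by
  simp [webToTabloid]

theorem webToTabloid_web_coeff (w : CupDiagram n) (t : Tabloid n) :
    (webToTabloid n (web w)).coeff t = matchEval w.partner t.rowVec := by
  rw [webToTabloid_web, w.polytabloid_tableau_coeff]

/-- Unitriangularity: if `w` has minimal left sum in the support, then at the tabloid of `w` every
other supported diagram evaluates to zero and `w` itself to one. -/
theorem webToTabloid_injective : Function.Injective (webToTabloid n) := by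
  rw [injective_iff_map_eq_zero]
  intro f hf
  by_contra hne
  have hs : f.support.Nonempty := Finsupp.support_nonempty_iff.2 hne
  obtain ⟨w, hw, hmin⟩ := f.support.exists_min_image CupDiagram.leftSum hs
  have h0 : (webToTabloid n f).coeff (Tabloid.mk w.tableau) = 0 := by rw [hf]; simp
  rw [webToTabloid, Finsupp.linearCombination_apply, Finsupp.sum, MonoidAlgebra.coeff_sum,
    Finsupp.finsetSum_apply, Finset.sum_eq_single w] at h0
  · rw [MonoidAlgebra.coeff_smul, Finsupp.smul_apply, w.polytabloid_tableau_coeff,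
      w.matchEval_self, smul_eq_mul, mul_one] at h0
    exact Finsupp.mem_support_iff.1 hw h0
  · intro w' hw' hww
    rw [MonoidAlgebra.coeff_smul, Finsupp.smul_apply, w'.polytabloid_tableau_coeff, smul_eq_mul]
    refine mul_eq_zero_of_right _ ?_
    by_contra hev
    obtain ⟨h1, h2⟩ := CupDiagram.leftSum_le_of_matchEval_ne_zero hev
    exact hww (h2 (le_antisymm h1 (hmin w' hw')))
  · exact fun h => absurd hw h

theorem tabloidRep_coeff (g : Perm (Fin (2 * n))) (f : MonoidAlgebra ℂ (Tabloid n))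
    (t : Tabloid n) : (tabloidRep n g f).coeff t = f.coeff (g⁻¹ • t) := by
  induction f using MonoidAlgebra.induction_linear with
  | zero => simp
  | add f g hf hg => simp only [map_add, MonoidAlgebra.coeff_add, Finsupp.add_apply, hf, hg]
  | single a b =>
    rw [Representation.ofMulAction_single, MonoidAlgebra.coeff_single, MonoidAlgebra.coeff_single]
    classical
    simp only [Finsupp.single_apply, smul_eq_iff_eq_inv_smul]

theorem webToTabloid_webSwap (i : ℕ) (hi : i + 1 < 2 * n) (f : WebSpace n) :
    webToTabloid n (webSwap i hi f) = tabloidRep n (simpleSwap i hi) (webToTabloid n f) := by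
  suffices h : webToTabloid n ∘ₗ webSwap i hi =
      tabloidRep n (simpleSwap i hi) ∘ₗ webToTabloid n from LinearMap.congr_fun h f
  refine Finsupp.lhom_ext' fun w => LinearMap.ext_ring ?_
  simp only [LinearMap.comp_apply, Finsupp.lsingle_apply]
  ext t
  rw [tabloidRep_coeff, webToTabloid_web_coeff, Tabloid.rowVec_smul, inv_inv, webSwap,
    Finsupp.linearCombination_single, one_smul]
  split_ifs with h
  · rw [map_neg, MonoidAlgebra.coeff_neg, Finsupp.neg_apply, webToTabloid_web_coeff, simpleSwap,
      matchEval_comp_eq_neg (by simp [Fin.lt_def]) w.isPerfectMatching h]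
  · rw [map_add, MonoidAlgebra.coeff_add, Finsupp.add_apply, webToTabloid_web_coeff,
      webToTabloid_web_coeff, w.matchEval_comp_simpleSwap i hi h]

/-- Stated for general `N` so that `N` can be split into zero and successor, which `2 * n` does not
allow. -/
theorem closure_adjacent_swap (N : ℕ) :
    Submonoid.closure {g : Perm (Fin N) | ∃ (i : ℕ) (hi : i + 1 < N),
      g = swap ⟨i, Nat.lt_of_succ_lt hi⟩ ⟨i + 1, hi⟩} = ⊤ := by
  cases N with
  | zero => exact Subsingleton.elim _ _
  | succ m =>
    rw [← Perm.mclosure_swap_castSucc_succ m]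
    congr 1
    ext g
    constructor
    · rintro ⟨i, hi, rfl⟩
      exact ⟨⟨i, by omega⟩, rfl⟩
    · rintro ⟨i, rfl⟩
      exact ⟨i.val, by omega, rfl⟩

theorem closure_simpleSwap (n : ℕ) :
    Submonoid.closure {g : Perm (Fin (2 * n)) | ∃ (i : ℕ) (hi : i + 1 < 2 * n),
      g = simpleSwap i hi} = ⊤ := closure_adjacent_swap (2 * n)

/-! ### The isomorphism of the web module with the Specht module -/

theorem tabloidRep_mem_range (g : Perm (Fin (2 * n))) (f : MonoidAlgebra ℂ (Tabloid n))
    (hf : f ∈ LinearMap.range (webToTabloid n)) :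
    tabloidRep n g f ∈ LinearMap.range (webToTabloid n) := by
  have hg : g ∈ Submonoid.closure {g : Perm (Fin (2 * n)) | ∃ (i : ℕ) (hi : i + 1 < 2 * n),
      g = simpleSwap i hi} := by rw [closure_simpleSwap]; trivial
  induction hg using Submonoid.closure_induction generalizing f with
  | mem g hg =>
    obtain ⟨i, hi, rfl⟩ := hg
    obtain ⟨f, rfl⟩ := hf
    exact ⟨webSwap i hi f, webToTabloid_webSwap i hi f⟩
  | one => simpa using hf
  | mul g h _ _ hg hh =>
    rw [map_mul]
    exact hg _ (hh _ hf)

theorem Tableau.exists_act_eq (T T' : Tableau n) : ∃ g, T' = T.act g :=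
  ⟨T.symm.trans T', by ext x; simp [Tableau.act]⟩

namespace StdTableau

theorem strictMono (T : StdTableau n) (r : Fin 2) : StrictMono fun c : Fin n => T.1 (r, c) :=
  T.2.1 r

theorem column_lt (T : StdTableau n) (c : Fin n) : T.1 (0, c) < T.1 (1, c) := T.2.2 c

theorem polytabloid_coeff (T : StdTableau n) (t : Tabloid n) :
    (polytabloid T.1).coeff t = matchEval T.1.partner t.rowVec :=
  T.1.polytabloid_coeff_eq_matchEval _ T.column_lt T.1.partner_zero T.1.partner_one t

theorem lt_partner_iff (T : StdTableau n) (x : Fin (2 * n)) :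
    x < T.1.partner x ↔ T.1.row x = 0 := by
  obtain ⟨⟨r, c⟩, rfl⟩ := T.1.surjective x
  have h := T.column_lt c
  have hr : r = 0 ∨ r = 1 := by omega
  rcases hr with rfl | rfl
  · simp [Tableau.partner_zero, h, Tableau.row]
  · simp [Tableau.partner_one, h.not_gt, Tableau.row]

/-- The columns of this tableau consist of neighbouring letters, so nothing lies under an arc and
the column matching is already noncrossing. -/
theorem initial_phi_partner :
    (initial n).phi.partner = (initial n).1.partner := by
  have hnc : ∀ a b, a < b → b < (initial n).1.partner a →
      (initial n).1.partner a < (initial n).1.partner b → False := by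
    intro a b hab hb _
    obtain ⟨⟨r, c⟩, rfl⟩ := (initial n).1.surjective a
    have h0 : ((initial n).1 (0, c)).val = _ := Tableau.columnReading_val 0 c
    have h1 : ((initial n).1 (1, c)).val = _ := Tableau.columnReading_val 1 c
    have hr : r = 0 ∨ r = 1 := by omega
    rw [Fin.lt_def] at *
    rcases hr with rfl | rfl
    · rw [Tableau.partner_zero] at hb
      rw [h0] at hab
      rw [h1] at hb
      simp at hab hb
      omega
    · rw [Tableau.partner_one] at hb
      rw [h1] at hab
      rw [h0] at hb
      simp at hab hb
      omega
  have := (initial n).eq_phi ⟨(initial n).1.partner, (initial n).1.isPerfectMatching_partner.invol,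
    (initial n).1.isPerfectMatching_partner.ne, hnc⟩ (initial n).lt_partner_iff
  rw [← this]

end StdTableau

theorem webToTabloid_initial :
    webToTabloid n (web (StdTableau.initial n).phi) = polytabloid (StdTableau.initial n).1 := by
  ext t
  rw [webToTabloid_web_coeff, StdTableau.polytabloid_coeff, StdTableau.initial_phi_partner]

/-- The range is stable under the group and contains the polytabloid of the initial tableau, whose
orbit consists of all polytabloids. -/
theorem range_webToTabloid : LinearMap.range (webToTabloid n) = (specht n).toSubmodule := by
  refine le_antisymm ?_ ?_
  · rintro _ ⟨f, rfl⟩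
    induction f using Finsupp.induction_linear with
    | zero => simp
    | add f g hf hg => rw [map_add]; exact Submodule.add_mem _ hf hg
    | single w a =>
      rw [webToTabloid, Finsupp.linearCombination_single]
      exact Submodule.smul_mem _ _ (Submodule.subset_span ⟨_, rfl⟩)
  · refine Submodule.span_le.2 ?_
    rintro _ ⟨T, rfl⟩
    obtain ⟨g, rfl⟩ := (StdTableau.initial n).1.exists_act_eq T
    rw [← tabloidRep_polytabloid]
    exact tabloidRep_mem_range g _ ⟨_, webToTabloid_initial⟩

/-- The linear isomorphism from the web module to the Specht module. -/
noncomputable def webEquivSpecht (n : ℕ) : WebSpace n ≃ₗ[ℂ] (specht n).toSubmodule :=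
  (LinearEquiv.ofInjective (webToTabloid n) webToTabloid_injective).trans
    (LinearEquiv.ofEq _ _ range_webToTabloid)

theorem webEquivSpecht_coe (f : WebSpace n) :
    (webEquivSpecht n f : MonoidAlgebra ℂ (Tabloid n)) = webToTabloid n f := rfl

theorem webEquivSpecht_webSwap (i : ℕ) (hi : i + 1 < 2 * n) (f : WebSpace n) :
    webEquivSpecht n (webSwap i hi f) = spechtRep n (simpleSwap i hi) (webEquivSpecht n f) :=
  Subtype.ext (webToTabloid_webSwap i hi f)

theorem webEquivSpecht_initial :
    webEquivSpecht n (web (StdTableau.initial n).phi) = stdPolytabloid (StdTableau.initial n) :=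
  Subtype.ext webToTabloid_initial

theorem webEquivSpecht_intertwines {σ : Representation ℂ (Perm (Fin (2 * n))) (WebSpace n)}
    (hσ : IsWebAction σ) (g : Perm (Fin (2 * n))) (f : WebSpace n) :
    webEquivSpecht n (σ g f) = spechtRep n g (webEquivSpecht n f) := by
  have hg : g ∈ Submonoid.closure {g : Perm (Fin (2 * n)) | ∃ (i : ℕ) (hi : i + 1 < 2 * n),
      g = simpleSwap i hi} := by rw [closure_simpleSwap]; trivial
  induction hg using Submonoid.closure_induction generalizing f with
  | mem g hg =>
    obtain ⟨i, hi, rfl⟩ := hg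
    rw [hσ i hi, webEquivSpecht_webSwap]
  | one => simp
  | mul g h _ _ hg hh => rw [map_mul, map_mul, Module.End.mul_apply, Module.End.mul_apply, hg, hh]

/-- The action of the symmetric group on the web module, transported from the Specht module. -/
noncomputable def webAction (n : ℕ) : Representation ℂ (Perm (Fin (2 * n))) (WebSpace n) where
  toFun g := (webEquivSpecht n).symm.toLinearMap ∘ₗ spechtRep n g ∘ₗ (webEquivSpecht n).toLinearMap
  map_one' := by ext1 w; ext1; simp
  map_mul' g h := by
    refine LinearMap.ext fun f => ?_
    rw [map_mul]
    simp only [LinearMap.comp_apply, Module.End.mul_apply, LinearEquiv.coe_coe,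
      LinearEquiv.apply_symm_apply]

theorem isWebAction_webAction (n : ℕ) : IsWebAction (webAction n) := fun i hi => by
  refine LinearMap.ext fun f => (webEquivSpecht n).injective ?_
  rw [webEquivSpecht_webSwap]
  exact (webEquivSpecht n).apply_symm_apply _

/-- Existence by transport from the Specht module; any web action is intertwined with it by the same
bijection, hence is unique. -/
theorem existsUnique_webAction (n : ℕ) :
    ∃! σ : Representation ℂ (Perm (Fin (2 * n))) (WebSpace n), IsWebAction σ := by
  refine ⟨webAction n, isWebAction_webAction n, fun σ hσ => ?_⟩
  refine MonoidHom.ext fun g => LinearMap.ext fun f => (webEquivSpecht n).injective ?_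
  rw [webEquivSpecht_intertwines hσ, webEquivSpecht_intertwines (isWebAction_webAction n)]

/-- The inverse isomorphism, as an isomorphism of representations. -/
noncomputable def spechtEquivWeb {σ : Representation ℂ (Perm (Fin (2 * n))) (WebSpace n)}
    (hσ : IsWebAction σ) : (spechtRep n).Equiv σ :=
  Representation.Equiv.mk (webEquivSpecht n).symm fun g => LinearMap.ext fun v =>
    (webEquivSpecht n).injective <| by
      simp only [LinearMap.comp_apply, LinearEquiv.coe_coe]
      rw [webEquivSpecht_intertwines hσ, LinearEquiv.apply_symm_apply,
        LinearEquiv.apply_symm_apply]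

theorem spechtEquivWeb_apply {σ : Representation ℂ (Perm (Fin (2 * n))) (WebSpace n)}
    (hσ : IsWebAction σ) (v : (specht n).toSubmodule) :
    spechtEquivWeb hσ v = (webEquivSpecht n).symm v := rfl

/-- The polytabloids span and form a single orbit, so an equivariant map is fixed by its value on
one of them. -/
theorem eq_spechtEquivWeb {σ : Representation ℂ (Perm (Fin (2 * n))) (WebSpace n)}
    (hσ : IsWebAction σ) (ρ : (spechtRep n).Equiv σ)
    (hρ : ρ (stdPolytabloid (StdTableau.initial n)) = web (StdTableau.initial n).phi) :
    ρ = spechtEquivWeb hσ := by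
  have key : ∀ (τ : (spechtRep n).Equiv σ) (g : Perm (Fin (2 * n))) (v : (specht n).toSubmodule),
      τ (spechtRep n g v) = σ g (τ v) := fun τ g v =>
    LinearMap.congr_fun (τ.toIntertwiningMap.isIntertwining' g) v
  have hspan : Submodule.span ℂ (Set.range fun T : Tableau n =>
      (⟨polytabloid T, Submodule.subset_span ⟨T, rfl⟩⟩ : (specht n).toSubmodule)) = ⊤ := by
    refine Eq.trans (congrArg _ ?_)
      (Submodule.span_span_coe_preimage (R := ℂ) (s := Set.range (polytabloid (n := n))))
    ext v
    exact exists_congr fun T => Subtype.ext_iff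
  have hlin : ρ.toLinearEquiv.toLinearMap = (spechtEquivWeb hσ).toLinearEquiv.toLinearMap := by
    refine LinearMap.ext_on_range hspan fun T => ?_
    obtain ⟨g, rfl⟩ := (StdTableau.initial n).1.exists_act_eq T
    have hT : (⟨polytabloid ((StdTableau.initial n).1.act g), Submodule.subset_span ⟨_, rfl⟩⟩ :
        (specht n).toSubmodule) = spechtRep n g (stdPolytabloid (StdTableau.initial n)) :=
      Subtype.ext (tabloidRep_polytabloid g _).symm
    rw [hT]
    change ρ _ = spechtEquivWeb hσ _
    rw [key, key, hρ, spechtEquivWeb_apply, ← webEquivSpecht_initial, LinearEquiv.symm_apply_apply]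
  exact Representation.Equiv.toLinearEquiv_injective (LinearEquiv.toLinearMap_injective hlin)

/-! ### Positive expansion of matchings into webs -/

/-- Crossings are resolved repeatedly, the spread guaranteeing termination. In the order on ℂ, `0 ≤
f w` also says that the coefficient is real. The last clause follows the branch of nested
resolutions, which preserves left endpoints; nonnegativity rules out cancellation. -/
theorem exists_web_expansion (p : Fin (2 * n) → Fin (2 * n)) (hp : IsPerfectMatching p) :
    ∃ f : WebSpace n, (∀ w, 0 ≤ f w) ∧
      (∀ t, (webToTabloid n f).coeff t = matchEval p t.rowVec) ∧
      (∀ w, f w ≠ 0 → ∀ k, matchHeight w.partner k ≤ matchHeight p k) ∧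
      ∃ w, f w ≠ 0 ∧ ∀ x, x < w.partner x ↔ x < p x := by
  induction hN : (matchSpread p).toNat using Nat.strong_induction_on generalizing p with
  | _ N ih =>
    subst hN
    by_cases hnc : ∀ a b, a < b → b < p a → p a < p b → False
    · classical
      let w : CupDiagram n := ⟨p, hp.invol, hp.ne, hnc⟩
      refine ⟨web w, fun w' => ?_, webToTabloid_web_coeff w, fun w' hw' k => ?_, w, by simp,
        fun _ => Iff.rfl⟩
      · rw [Finsupp.single_apply]
        split_ifs
        · exact zero_le_one
        · exact le_rfl
      · have : w = w' := by
          by_contra h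
          exact hw' (Finsupp.single_eq_of_ne (Ne.symm h))
        rw [← this]
    · push Not at hnc
      obtain ⟨a, b, hab, hb, hc, -⟩ := hnc
      have hcr : Crossing p a b (p a) (p b) :=
        ⟨hab, hb, hc, rfl, rfl, hp.invol a, hp.invol b⟩
      obtain ⟨q, hqm, hq⟩ := exists_joinedSplit hp hcr
      obtain ⟨q', hqm', hq'⟩ := exists_joinedNested hp hcr
      have l1 := hq.matchSpread_lt hcr
      have l2 := hq'.matchSpread_lt hcr
      have l3 := matchSpread_nonneg q
      have l4 := matchSpread_nonneg q'
      obtain ⟨f, f0, f1, f2, -⟩ := ih _ (by omega) q hqm rfl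
      obtain ⟨g, g0, g1, g2, w, g3, g4⟩ := ih _ (by omega) q' hqm' rfl
      refine ⟨f + g, fun w => add_nonneg (f0 w) (g0 w), fun t => ?_, fun w' hw' k => ?_, w, ?_,
        fun x => (g4 x).trans (hq'.lt_iff hcr x)⟩
      · rw [map_add, MonoidAlgebra.coeff_add, Finsupp.add_apply, f1, g1,
          matchEval_plucker hcr hq hq']
      · by_cases hf : f w' = 0
        · have hg : g w' ≠ 0 := fun hg => hw' (by rw [Finsupp.add_apply, hf, hg, add_zero])
          refine (g2 w' hg k).trans (le_of_eq ?_)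
          simp only [matchHeight, hq'.lt_iff hcr]
        · exact (f2 w' hf k).trans (hq.matchHeight_le hcr k)
      · exact (add_pos_of_nonneg_of_pos (f0 w) (lt_of_le_of_ne (g0 w) g3.symm)).ne'

/-! ### Web coordinates of standard polytabloids -/

namespace StdTableau

theorem matchHeight_eq_height (T : StdTableau n) (p : Fin (2 * n) → Fin (2 * n))
    (hp : ∀ x, x < p x ↔ T.1.row x = 0) (k : ℕ) : matchHeight p k = T.height k := by
  simp only [matchHeight, hp]
  rw [← Equiv.sum_comp T.1, Fintype.sum_prod_type, Fin.sum_univ_two, ← Finset.sum_add_distrib,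
    height]
  refine Finset.sum_congr rfl fun c _ => ?_
  simp only [Tableau.row, Equiv.symm_apply_apply, if_true, one_ne_zero, if_false]
  split_ifs <;> rfl

/-- The coordinates of a standard polytabloid in the web basis. -/
noncomputable def webCoord (T : StdTableau n) : WebSpace n :=
  (webEquivSpecht n).symm (stdPolytabloid T)

theorem webCoord_eq (T : StdTableau n) (f : WebSpace n)
    (hf : ∀ t, (webToTabloid n f).coeff t = matchEval T.1.partner t.rowVec) : T.webCoord = f := by
  rw [webCoord, LinearEquiv.symm_apply_eq]
  refine Subtype.ext ?_
  rw [webEquivSpecht_coe]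
  ext t
  rw [hf]
  exact T.polytabloid_coeff t

theorem webToTabloid_webCoord (T : StdTableau n) (t : Tabloid n) :
    (webToTabloid n T.webCoord).coeff t = matchEval T.1.partner t.rowVec := by
  rw [← webEquivSpecht_coe, webCoord, LinearEquiv.apply_symm_apply]
  exact T.polytabloid_coeff t

theorem webCoord_spec (T : StdTableau n) :
    (∀ w, 0 ≤ T.webCoord w) ∧
      (∀ S : StdTableau n, T.webCoord S.phi ≠ 0 → ∀ k, S.height k ≤ T.height k) ∧
      0 < T.webCoord T.phi := by
  obtain ⟨f, f0, f1, f2, w, f3, f4⟩ := exists_web_expansion _ T.1.isPerfectMatching_partner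
  rw [T.webCoord_eq f f1]
  refine ⟨f0, fun S hS k => ?_, ?_⟩
  · rw [← S.matchHeight_eq_height _ S.phi_spec, ← T.matchHeight_eq_height _ T.lt_partner_iff]
    exact f2 _ hS k
  · have hw : w = T.phi := T.eq_phi w fun x => (f4 x).trans (T.lt_partner_iff x)
    rw [← hw]
    exact lt_of_le_of_ne (f0 w) f3.symm

/-- In `T` the arc ending at `i` lies entirely to the left of the arc starting at `i + 1`.
Exchanging the two letters makes these arcs cross in `R`; the split resolution gives back `T`, and
the nested one adds a nonnegative expansion. -/
theorem Edge.webCoord_le {T R : StdTableau n} (h : Edge T R) (w : CupDiagram n) :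
    T.webCoord w ≤ R.webCoord w := by
  obtain ⟨i, hi, hrow, hR⟩ := h
  have huv : (⟨i, Nat.lt_of_succ_lt hi⟩ : Fin (2 * n)) < ⟨i + 1, hi⟩ := by simp [Fin.lt_def]
  have hcov : ∀ x : Fin (2 * n), x < ⟨i + 1, hi⟩ → x ≤ ⟨i, Nat.lt_of_succ_lt hi⟩ := fun x hx => by
    simp only [Fin.lt_def, Fin.le_def] at *; omega
  unfold simpleSwap at hR
  generalize (⟨i, Nat.lt_of_succ_lt hi⟩ : Fin (2 * n)) = u at *
  generalize (⟨i + 1, hi⟩ : Fin (2 * n)) = v at *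
  have hv : v < T.1.partner v := by rw [T.lt_partner_iff]; omega
  have hu : ¬ u < T.1.partner u := by rw [T.lt_partner_iff]; omega
  obtain ⟨i1, i2⟩ := T.1.isPerfectMatching_partner
  have hu' : T.1.partner u < u := lt_of_le_of_ne (not_lt.1 hu) (i2 u)
  have hconj : ∀ x, R.1.partner (swap u v x) = swap u v (T.1.partner x) := by
    intro x
    obtain ⟨⟨r, c⟩, rfl⟩ := T.1.surjective x
    have hRT : ∀ rc, swap u v (T.1 rc) = R.1 rc := fun rc => by rw [hR]; rfl
    have hr : r = 0 ∨ r = 1 := by omega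
    rcases hr with rfl | rfl
    · rw [hRT, Tableau.partner_zero, Tableau.partner_zero, hRT]
    · rw [hRT, Tableau.partner_one, Tableau.partner_one, hRT]
  have sx : ∀ x, x ≠ u → x ≠ v → swap u v x = x := fun x => swap_apply_of_ne_of_ne
  have k1 := hconj u
  have k2 := hconj v
  have k3 := hconj (T.1.partner u)
  have k4 := hconj (T.1.partner v)
  rw [swap_apply_left, sx _ (by grind) (by grind)] at k1
  rw [swap_apply_right, sx _ (by grind) (by grind)] at k2
  rw [i1, swap_apply_left, sx _ (by grind) (by grind)] at k3
  rw [i1, swap_apply_right, sx _ (by grind) (by grind)] at k4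
  have hcr : Crossing R.1.partner (T.1.partner u) u v (T.1.partner v) :=
    ⟨hu', huv, hv, k3, k2, k1, k4⟩
  have hsp : JoinedSplit R.1.partner T.1.partner (T.1.partner u) u v (T.1.partner v) := by
    refine ⟨i1 u, rfl, rfl, i1 v, fun x x1 x2 x3 x4 => ?_⟩
    have := hconj x
    rw [sx x x2 x3, sx (T.1.partner x) (by grind) (by grind)] at this
    exact this.symm
  obtain ⟨q, hq, hq'⟩ := exists_joinedNested R.1.isPerfectMatching_partner hcr
  obtain ⟨g, g0, g1, -⟩ := exists_web_expansion q hq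
  rw [R.webCoord_eq (T.webCoord + g) fun t => by
    rw [map_add, MonoidAlgebra.coeff_add, Finsupp.add_apply, webToTabloid_webCoord, g1,
      matchEval_plucker hcr hsp hq']]
  exact le_add_of_nonneg_right (g0 w)

theorem webCoord_le_of_le {T R : StdTableau n} (h : T ≤ R) (w : CupDiagram n) :
    T.webCoord w ≤ R.webCoord w := by
  induction (show Relation.ReflTransGen Edge T R from h) with
  | refl => exact le_rfl
  | tail hT e ih => exact (ih hT).trans (e.webCoord_le w)

/-! ### The tableau graph and heights -/

theorem ext_of_row {S T : StdTableau n} (h : ∀ x, S.1.row x = T.1.row x) : S = T := by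
  refine Subtype.ext (Equiv.ext ?_)
  rintro ⟨r, c⟩
  have hrange : ∀ U : StdTableau n, Set.range (fun c => U.1 (r, c)) = {x | U.1.row x = r} := by
    intro U
    ext x
    constructor
    · rintro ⟨c, rfl⟩
      simp [Tableau.row]
    · rintro hx
      exact ⟨U.1.col x, by rw [← (show U.1.row x = r from hx)]; simp [Tableau.row, Tableau.col]⟩
  refine congrFun ((StrictMono.range_inj (S.strictMono r) (T.strictMono r)).1 ?_) c
  rw [hrange, hrange]
  simp only [h]

theorem height_step (T : StdTableau n) (k : ℕ) (hk : k < 2 * n) :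
    T.height (k + 1) = T.height k + if T.1.row ⟨k, hk⟩ = 0 then 1 else -1 :=
  T.height_succ ⟨k, hk⟩

theorem ext_of_height {S T : StdTableau n} (h : ∀ k ≤ 2 * n, S.height k = T.height k) : S = T := by
  refine ext_of_row fun x => ?_
  have h1 := S.height_succ x
  have h2 := T.height_succ x
  rw [h _ (by omega), h _ (by omega)] at h1
  split_ifs at h1 h2 <;> omega

theorem height_emod_two (T : StdTableau n) (k : ℕ) (hk : k ≤ 2 * n) :
    T.height k % 2 = k % 2 := by
  induction k with
  | zero => simp [height_zero]
  | succ k ih =>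
    have := ih (by omega)
    rw [T.height_step k (by omega)]
    split_ifs <;> omega

theorem topSum_le (T : StdTableau n) : T.topSum ≤ n * (2 * n) := by
  have := Finset.sum_le_card_nsmul Finset.univ (fun c : Fin n => (T.1 (0, c)).val) (2 * n)
    fun c _ => (T.1 (0, c)).2.le
  simpa [topSum] using this

/-- The letters before such a column fill exactly the columns to its left. -/
theorem height_eq_zero_of_column (T : StdTableau n) (c : Fin n)
    (h : (T.1 (1, c)).val = (T.1 (0, c)).val + 1) : T.height (T.1 (0, c)).val = 0 := by
  refine Finset.sum_eq_zero fun c' _ => ?_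
  have h0 : (T.1 (0, c')).val < (T.1 (0, c)).val ↔ c' < c := (T.strictMono 0).lt_iff_lt
  have h1 : (T.1 (1, c')).val < (T.1 (1, c)).val ↔ c' < c := (T.strictMono 1).lt_iff_lt
  have hne : (T.1 (1, c')).val ≠ (T.1 (0, c)).val := fun e => by
    simpa using T.1.injective (Fin.ext e)
  have h2 : (T.1 (1, c')).val < (T.1 (0, c)).val ↔ c' < c := by rw [← h1]; omega
  simp only [h0, h2, sub_self]

theorem simpleSwap_lt {i : ℕ} (hi : i + 1 < 2 * n) {x y : Fin (2 * n)} (hxy : x < y)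
    (h : ¬ (x.val = i ∧ y.val = i + 1)) : simpleSwap i hi x < simpleSwap i hi y := by
  unfold simpleSwap
  rw [swap_apply_def, swap_apply_def]
  simp only [Fin.ext_iff, Fin.lt_def] at *
  split_ifs <;> (try simp only) <;> omega

/-- Lowering a peak whose two letters do not form a column. -/
theorem exists_edge_of_peak (T : StdTableau n) (i : ℕ) (hi : i + 1 < 2 * n)
    (h0 : T.1.row ⟨i, Nat.lt_of_succ_lt hi⟩ = 0) (h1 : T.1.row ⟨i + 1, hi⟩ = 1)
    (hpos : T.height i ≠ 0) :
    ∃ R : StdTableau n, Edge R T ∧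
      ∀ k ≤ 2 * n, R.height k = T.height k - if k = i + 1 then 2 else 0 := by
  have hrow : ∀ r c, (T.1 (r, c)).val = i → r = 0 := fun r c h => by
    have : T.1 (r, c) = ⟨i, Nat.lt_of_succ_lt hi⟩ := Fin.ext h
    rw [← h0, ← this]
    simp [Tableau.row]
  have hrow' : ∀ r c, (T.1 (r, c)).val = i + 1 → r = 1 := fun r c h => by
    have : T.1 (r, c) = ⟨i + 1, hi⟩ := Fin.ext h
    rw [← h1, ← this]
    simp [Tableau.row]
  -- Only the order of `i` and `i + 1` is reversed. They lie in different rows, and a common column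
  -- would force height zero before `i`.
  have hstd : (T.1.act (simpleSwap i hi)).IsStandard := by
    refine ⟨fun r c d hcd => simpleSwap_lt hi (T.strictMono r hcd) ?_,
      fun c => simpleSwap_lt hi (T.column_lt c) ?_⟩
    · rintro ⟨e1, e2⟩
      have := hrow _ _ e1
      have := hrow' _ _ e2
      omega
    · rintro ⟨e1, e2⟩
      exact hpos (by rw [← e1]; exact T.height_eq_zero_of_column c (by omega))
  let R : StdTableau n := ⟨_, hstd⟩
  have hR : ∀ x, R.1.row x = T.1.row (simpleSwap i hi x) := fun x => rfl
  have r0 : R.1.row ⟨i, Nat.lt_of_succ_lt hi⟩ = 1 := by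
    rw [hR, simpleSwap, swap_apply_left, h1]
  have r1 : R.1.row ⟨i + 1, hi⟩ = 0 := by
    rw [hR, simpleSwap, swap_apply_right, h0]
  refine ⟨R, ⟨i, hi, by rw [r0, r1]; decide, ?_⟩, fun k hk => ?_⟩
  · ext x
    simp [R, Tableau.act, simpleSwap]
  · induction k with
    | zero => simp [height_zero]
    | succ k ih =>
      have ih := ih (by omega)
      have e1 := R.height_step k (by omega)
      have e2 := T.height_step k (by omega)
      by_cases hk1 : k = i
      · subst hk1
        rw [r0] at e1
        rw [h0] at e2
        simp at e1 e2 ih ⊢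
        omega
      · by_cases hk2 : k = i + 1
        · subst hk2
          rw [r1] at e1
          rw [h1] at e2
          simp at e1 e2 ih ⊢
          omega
        · have : R.1.row ⟨k, by omega⟩ = T.1.row ⟨k, by omega⟩ := by
            rw [hR, simpleSwap, swap_apply_of_ne_of_ne] <;> simpa [Fin.ext_iff]
          rw [this] at e1
          rw [if_neg hk2] at ih
          rw [if_neg (by omega)]
          omega

/-- Among the positions where `T` is strictly higher than `S`, a highest point of `T` is a peak. By
parity the gap there is at least two, so lowering the peak by two keeps `T` above `S`; the upper row
sum grows and is bounded, so the process stops. -/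
theorem le_of_height_le {S T : StdTableau n} (h : ∀ k, S.height k ≤ T.height k) : S ≤ T := by
  induction hN : n * (2 * n) - T.topSum using Nat.strong_induction_on generalizing T with
  | _ N ih =>
    subst hN
    by_cases heq : ∀ k ≤ 2 * n, S.height k = T.height k
    · exact (ext_of_height heq).le
    push Not at heq
    obtain ⟨k₀, hk₀, hne₀⟩ := heq
    let s : Finset ℕ := {k ∈ Finset.range (2 * n + 1) | S.height k < T.height k}
    have hs : ∀ k, k ∈ s ↔ k ≤ 2 * n ∧ S.height k < T.height k := fun k => by
      simp [s]
    obtain ⟨k, hk, hmax⟩ := s.exists_max_image T.height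
      ⟨k₀, (hs _).2 ⟨hk₀, lt_of_le_of_ne (h _) hne₀⟩⟩
    rw [hs] at hk
    obtain ⟨hk2, hlt⟩ := hk
    have hkn : k ≠ 2 * n := by
      rintro rfl
      rw [height_end, height_end] at hlt
      exact lt_irrefl _ hlt
    obtain _ | i := k
    · rw [height_zero, height_zero] at hlt
      exact absurd hlt (lt_irrefl _)
    have hi : i + 1 < 2 * n := by omega
    have a1 := S.height_step i (by omega)
    have a2 := T.height_step i (by omega)
    have b1 := S.height_step (i + 1) hi
    have b2 := T.height_step (i + 1) hi
    -- If `T` stepped down here, the previous position would be higher and the gap to `S` still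
    -- positive, because `S` steps down by at most one.
    have h0 : T.1.row ⟨i, Nat.lt_of_succ_lt hi⟩ = 0 := by
      by_contra hr
      rw [if_neg hr] at a2
      have hlt' : S.height i < T.height i := by split_ifs at a1 <;> omega
      have := hmax i ((hs i).2 ⟨by omega, hlt'⟩)
      omega
    have h1 : T.1.row ⟨i + 1, hi⟩ = 1 := by
      by_contra hr
      rw [if_pos (by omega)] at b2
      have hlt' : S.height (i + 1 + 1) < T.height (i + 1 + 1) := by split_ifs at b1 <;> omega
      have := hmax (i + 1 + 1) ((hs _).2 ⟨by omega, hlt'⟩)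
      omega
    have p1 := S.height_emod_two (i + 1) hk2
    have p2 := T.height_emod_two (i + 1) hk2
    have hnn := S.height_nonneg (i + 1)
    rw [if_pos h0] at a2
    -- The peak has height at least `S.height (i + 1) + 2 ≥ 2`, so the height before it is not zero.
    obtain ⟨R, hedge, hR⟩ := T.exists_edge_of_peak i hi h0 h1 (by omega)
    have htop := hedge.topSum_lt
    have hb := R.topSum_le
    refine (ih _ (by omega) (T := R) (fun k => ?_) rfl).trans (Relation.ReflTransGen.single hedge)
    rcases le_or_gt k (2 * n) with hk | hk
    · rw [hR k hk]
      have := h k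
      split_ifs with hki
      · subst hki
        omega
      · omega
    · have hend : ∀ U : StdTableau n, U.height k = 0 := fun U => by
        refine Finset.sum_eq_zero fun c _ => ?_
        rw [if_pos (by omega), if_pos (by omega), sub_self]
      rw [hend, hend]

theorem webCoord_pos_iff (S T : StdTableau n) : 0 < T.webCoord S.phi ↔ S ≤ T :=
  ⟨fun h => le_of_height_le (T.webCoord_spec.2.1 S h.ne'),
    fun h => S.webCoord_spec.2.2.trans_le (webCoord_le_of_le h _)⟩

end StdTableau

end WebModule

theorem theorem3 (n : ℕ) :
    (∃! σ : Representation ℂ (Equiv.Perm (Fin (2 * n))) (WebSpace n), IsWebAction σ) ∧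
    ∀ σ : Representation ℂ (Equiv.Perm (Fin (2 * n))) (WebSpace n), IsWebAction σ →
      (∃! ρ : (spechtRep n).Equiv σ,
        ρ (stdPolytabloid (StdTableau.initial n)) = web (StdTableau.initial n).phi) ∧
      ∀ ρ : (spechtRep n).Equiv σ,
        ρ (stdPolytabloid (StdTableau.initial n)) = web (StdTableau.initial n).phi →
        ∀ S T : StdTableau n, 0 < transitionEntry ρ S T ↔ S ≤ T := by
  refine ⟨existsUnique_webAction n, fun σ hσ => ⟨⟨spechtEquivWeb hσ, ?_, eq_spechtEquivWeb hσ⟩,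
    fun ρ hρ S T => ?_⟩⟩
  · beta_reduce
    rw [spechtEquivWeb_apply, ← webEquivSpecht_initial, LinearEquiv.symm_apply_apply]
  · rw [eq_spechtEquivWeb hσ ρ hρ]
    exact StdTableau.webCoord_pos_iff S T
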